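/- For a finite group $G$ and an integer $n\ge 1$ let $G\wr S_n$ be the complete monomial group: its elements are the tuples $(g_1,\dots,g_n;\pi)$ with $g_i\in G$, $\pi\in S_n$, and the product is $(g_1,\dots,g_n;\pi)(h_1,\dots,h_n;\eta)=(g_1h_{\pi^{-1}(1)},\dots,g_nh_{\pi^{-1}(n)};\pi\eta)$. Let $(G_n)_{n\ge 1}$ be any sequence of non-trivial finite groups and put $\mathcal G_n=G_n\wr S_n$. The warp-transpose top with random shuffle on $\mathcal G_n$ is the random walk with transition probabilities $M(x,y)=P_n(x^{-1}y)$, where $$P_n(x)=\begin{cases}\frac{1}{n|G_n|}, & x=(1,\dots,1,g;\mathrm{id}),\ g\in G_n,\\[2pt] \frac{1}{n|G_n|}, & x=(1,\dots,1,g^{-1},1,\dots,1,g;(i,n)),\ g\in G_n,\ 1\le i<n,\\[2pt] 0,&\text{otherwise,}\end{cases}$$ with $g^{-1}$ in the $i$th and $g$ in the $n$th position in the second line. Let $P_n^{*k}$ be the $k$-fold convolution power of $P_n$ (the law of the walk started at the identity after $k$ steps), $U_{\mathcal G_n}$ the uniform distribution on $\mathcal G_n$, and $\|\mu-\nu\|_{\mathrm{TV}}=\sup_{A}|\mu(A)-\nu(A)|$.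 Then the shuffle exhibits total variation cutoff at time $n\log n$, whatever the orders $|G_n|$ are. That is: for every $n\ge1$, $P_n$ is a probability measure whose support generates $\mathcal G_n$, and the walk is irreducible and aperiodic; $n\log n\to\infty$; and for every $\epsilon\in(0,1)$, $$\lim_{n\to\infty}\left\|P_n^{*\lfloor(1+\epsilon)n\log n\rfloor}-U_{\mathcal G_n}\right\|_{\mathrm{TV}}=0,\qquad \lim_{n\to\infty}\left\|P_n^{*\lfloor(1-\epsilon)n\log n\rfloor}-U_{\mathcal G_n}\right\|_{\mathrm{TV}}=1 .$$ -/

import Mathlib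

open Filter Topology

noncomputable section

/-! ### Random walks on finite groups -/

namespace RandomWalk

/-- A probability measure on a finite set, given by its point masses. -/
def IsProb {Ω : Type*} [Fintype Ω] (p : Ω → ℝ) : Prop :=
  (∀ x, 0 ≤ p x) ∧ ∑ x, p x = 1

/-- The total variation distance `sup_A |μ(A) - ν(A)|`. -/
def tvDist {Ω : Type*} (μ ν : Ω → ℝ) : ℝ :=
  ⨆ A : Finset Ω, |∑ x ∈ A, μ x - ∑ x ∈ A, ν x|

/-- The uniform distribution. -/
def unif (Ω : Type*) [Fintype Ω] : Ω → ℝ :=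
  fun _ => 1 / (Fintype.card Ω : ℝ)

/-- The convolution `(p * q)(x) = ∑_y p(x y⁻¹) q(y)`. -/
def conv {G : Type*} [Group G] [Fintype G] (p q : G → ℝ) : G → ℝ :=
  fun x => ∑ y, p (x * y⁻¹) * q y

open Classical in
/-- The `k`-fold convolution power of `p`; the power `0` is the unit mass at `1`. -/
def convPow {G : Type*} [Group G] [Fintype G] (p : G → ℝ) : ℕ → G → ℝ
  | 0 => fun x => if x = 1 then 1 else 0
  | k + 1 => conv p (convPow p k)

/-- The transition matrix `M(x, y) = p(x⁻¹ y)` of the random walk driven by `p`. -/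
def transition {G : Type*} [Group G] (p : G → ℝ) : Matrix G G ℝ :=
  Matrix.of fun x y => p (x⁻¹ * y)

open Classical in
/-- Every state can be reached from every state with positive probability. -/
def IsIrred {Ω : Type*} [Fintype Ω] (M : Matrix Ω Ω ℝ) : Prop :=
  ∀ x y, ∃ k : ℕ, 0 < (M ^ k) x y

open Classical in
/-- The positive times at which a return to the starting state `x` is possible. -/
def returnTimes {Ω : Type*} [Fintype Ω] (M : Matrix Ω Ω ℝ) (x : Ω) : Set ℕ :=
  {k | 1 ≤ k ∧ 0 < (M ^ k) x x}

/-- Every state has period `1`: the greatest common divisor of its return times is `1`. -/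
def IsAperiodic {Ω : Type*} [Fintype Ω] (M : Matrix Ω Ω ℝ) : Prop :=
  ∀ x, ∀ d : ℕ, (∀ k ∈ returnTimes M x, d ∣ k) → d = 1

/-- Total variation cutoff at time `T n` for a family of random walks on finite groups.
The times `T n` are positive for all large `n`, because they tend to infinity. -/
structure HasTVCutoff {ι : Type*} [Preorder ι] (G : ι → Type*) [∀ n, Group (G n)]
    [∀ n, Fintype (G n)] (p : ∀ n, G n → ℝ) (T : ι → ℝ) : Prop where
  isProb : ∀ n, IsProb (p n)
  generates : ∀ n, Subgroup.closure (Function.support (p n)) = ⊤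
  irreducible : ∀ n, IsIrred (transition (p n))
  aperiodic : ∀ n, IsAperiodic (transition (p n))
  tendsto_time : Tendsto T atTop atTop
  upper : ∀ ε : ℝ, 0 < ε → ε < 1 →
    Tendsto (fun n => tvDist (convPow (p n) ⌊(1 + ε) * T n⌋₊) (unif (G n))) atTop (𝓝 0)
  lower : ∀ ε : ℝ, 0 < ε → ε < 1 →
    Tendsto (fun n => tvDist (convPow (p n) ⌊(1 - ε) * T n⌋₊) (unif (G n))) atTop (𝓝 1)

end RandomWalk

/-! ### The complete monomial group and the shuffle -/

/-- The complete monomial group `G ≀ S_n`: pairs `(g; π)` with the product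
`(g; π) (h; η) = (i ↦ g i * h (π⁻¹ i); π η)`. -/
abbrev Monomial (G : Type*) [Group G] (n : ℕ) : Type _ :=
  (Fin n → G) ⋊[mulAutArrow] Equiv.Perm (Fin n)

namespace Monomial

instance (G : Type*) [Group G] [Fintype G] (n : ℕ) : Fintype (Monomial G n) :=
  Fintype.ofEquiv _ SemidirectProduct.equivProd.symm

/-- The product is the one of the complete monomial group. -/
theorem mul_eq (G : Type*) [Group G] (n : ℕ) (g h : Fin n → G) (π η : Equiv.Perm (Fin n)) :
    (⟨g, π⟩ * ⟨h, η⟩ : Monomial G n) = ⟨fun i => g i * h (π⁻¹ i), π * η⟩ := rfl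

/-- The element `(1, …, 1, g; id)`; the last position is `⊤ : Fin n`. -/
def lastElt {G : Type*} [Group G] {n : ℕ} [NeZero n] (g : G) : Monomial G n :=
  ⟨Pi.mulSingle ⊤ g, 1⟩

/-- For `i ≠ ⊤`, the element `(1, …, 1, g⁻¹, 1, …, 1, g; (i, n))`, with `g⁻¹` in position `i`
and `g` in the last position. -/
def warpElt {G : Type*} [Group G] {n : ℕ} [NeZero n] (i : Fin n) (g : G) : Monomial G n :=
  ⟨Pi.mulSingle i g⁻¹ * Pi.mulSingle ⊤ g, Equiv.swap i ⊤⟩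

open Classical in
/-- The measure driving the warp-transpose top with random shuffle on `G ≀ S_n`. -/
def warpTranspose (G : Type*) [Group G] [Fintype G] (n : ℕ) [NeZero n] : Monomial G n → ℝ :=
  fun x =>
    if (∃ g : G, x = lastElt g) ∨ (∃ i : Fin n, i < ⊤ ∧ ∃ g : G, x = warpElt i g)
    then 1 / ((n : ℝ) * (Fintype.card G : ℝ))
    else 0

end Monomial

end

/-!
Every increment of the shuffle has in its `S_n` component a star transposition `(i t)`, with `t` the
last place and `i` uniform (the identity if `i = t`); it multiplies the entry of `t` by a uniform
element and, if `i ≠ t`, that of `i` by its inverse. Given the word of the places `i`, the entries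
that have been randomised are independent and uniform, so the distance to uniformity is at most that
of the star transposition walk on `S_n` plus the probability that some entry has not been
randomised. Both become small at `n log n`, with no dependence on `|G_n|`.

The star transposition walk is bounded in `ℓ²` by the trace of a power of its transition matrix,
which is `(J + 1) / n` for the Jucys–Murphy operator `J = ∑ i ≠ t, (i t)` of the regular
representation. If `J v = c v` with `c` above `n - 2 - j`, then `v` is a combination of functions
depending on only `j` values of a permutation; so at most `n ^ (2 * j)` eigenvalues are this large,
and twisting by the sign deals with the negative ones in the same way.

For the lower bound, a place `i ≠ t` missing from the word is a fixed point of the star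
transposition walk. Before `n log n` many places are missing, whereas a uniform permutation has one
fixed point on average.
-/

open scoped BigOperators

namespace RandomWalk

/-! ### Total variation distance -/

section TotalVariation

variable {Ω : Type*}

theorem tvDist_nonneg (μ ν : Ω → ℝ) : 0 ≤ tvDist μ ν :=
  Real.iSup_nonneg fun _ => abs_nonneg _

theorem abs_sum_sub_sum_le_tvDist [Finite Ω] (μ ν : Ω → ℝ) (A : Finset Ω) :
    |∑ x ∈ A, μ x - ∑ x ∈ A, ν x| ≤ tvDist μ ν :=
  le_ciSup (f := fun A : Finset Ω => |∑ x ∈ A, μ x - ∑ x ∈ A, ν x|)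
    (Set.finite_range _).bddAbove A

theorem tvDist_triangle [Finite Ω] (μ ν ξ : Ω → ℝ) :
    tvDist μ ξ ≤ tvDist μ ν + tvDist ν ξ :=
  ciSup_le fun A => (abs_sub_le _ (∑ x ∈ A, ν x) _).trans
    (add_le_add (abs_sum_sub_sum_le_tvDist μ ν A) (abs_sum_sub_sum_le_tvDist ν ξ A))

theorem tvDist_expect_le [Finite Ω] {ι : Type*} [Fintype ι] (μ ν : ι → Ω → ℝ) :
    tvDist (𝔼 i, μ i) (𝔼 i, ν i) ≤ 𝔼 i, tvDist (μ i) (ν i) := by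
  refine ciSup_le fun A => ?_
  simp only [Finset.expect_apply, ← Finset.expect_sum_comm, ← Finset.expect_sub_distrib]
  exact (Finset.abs_expect_le _ _).trans
    (Finset.expect_le_expect fun i _ => abs_sum_sub_sum_le_tvDist (μ i) (ν i) A)

variable [Fintype Ω]

theorem two_mul_tvDist {μ ν : Ω → ℝ} (h : ∑ x, μ x = ∑ x, ν x) :
    2 * tvDist μ ν = ∑ x, |μ x - ν x| := by
  classical
  apply le_antisymm
  · rw [mul_comm, ← le_div_iff₀ two_pos]
    refine ciSup_le fun A => ?_
    have hμ := Finset.sum_add_sum_compl A μ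
    have hν := Finset.sum_add_sum_compl A ν
    have hsum := Finset.sum_add_sum_compl A fun x => |μ x - ν x|
    have hA := Finset.abs_sum_le_sum_abs (fun x => μ x - ν x) A
    have hAc := Finset.abs_sum_le_sum_abs (fun x => μ x - ν x) Aᶜ
    rw [Finset.sum_sub_distrib] at hA hAc
    rw [show ∑ x ∈ Aᶜ, μ x - ∑ x ∈ Aᶜ, ν x = -(∑ x ∈ A, μ x - ∑ x ∈ A, ν x) by linarith,
      abs_neg] at hAc
    linarith
  · have hpos := abs_sum_sub_sum_le_tvDist μ ν {x | ν x ≤ μ x}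
    have habs : ∀ x, |μ x - ν x| = 2 * (if ν x ≤ μ x then μ x - ν x else 0) - (μ x - ν x) := by
      intro x
      split_ifs with hx
      · rw [abs_of_nonneg (by linarith)]
        ring
      · rw [abs_of_neg (by linarith)]
        ring
    rw [Finset.sum_congr rfl fun x _ => habs x, Finset.sum_sub_distrib, ← Finset.mul_sum,
      ← Finset.sum_filter, Finset.sum_sub_distrib, Finset.sum_sub_distrib, h, sub_self, sub_zero]
    exact mul_le_mul_of_nonneg_left ((le_abs_self _).trans hpos) two_pos.le

theorem tvDist_le_one {μ ν : Ω → ℝ} (hμ : IsProb μ) (hν : IsProb ν) : tvDist μ ν ≤ 1 := by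
  have hmem {ξ : Ω → ℝ} (hξ : IsProb ξ) (A : Finset Ω) :
      0 ≤ ∑ x ∈ A, ξ x ∧ ∑ x ∈ A, ξ x ≤ 1 :=
    ⟨Finset.sum_nonneg fun x _ => hξ.1 x,
      (Finset.sum_le_univ_sum_of_nonneg hξ.1).trans_eq hξ.2⟩
  exact ciSup_le fun A => abs_sub_le_of_le_of_le (hmem hμ A).1 (hmem hμ A).2 (hmem hν A).1
    (hmem hν A).2 |>.trans_eq (sub_zero 1)

theorem isProb_unif (Ω : Type*) [Fintype Ω] [Nonempty Ω] : IsProb (unif Ω) :=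
  ⟨fun _ => one_div_nonneg.2 (Nat.cast_nonneg _), by simp [unif]⟩

theorem two_mul_tvDist_unif_le {μ : Ω → ℝ} (hμ : ∑ x, μ x = 1) :
    2 * tvDist μ (unif Ω) ≤
      √(Fintype.card Ω * ∑ x, (μ x - 1 / Fintype.card Ω) ^ 2) := by
  have : Nonempty Ω := by
    by_contra! h
    simp at hμ
  rw [two_mul_tvDist (hμ.trans (isProb_unif Ω).2.symm)]
  refine Real.le_sqrt_of_sq_le ?_
  simpa [unif] using
    sq_sum_le_card_mul_sum_sq (s := Finset.univ) (f := fun x : Ω => |μ x - unif Ω x|)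

end TotalVariation

/-! ### Point masses and image measures -/

section Pushforward

variable {Ω Ω' : Type*}

open Classical in
/-- The unit mass at `a`. -/
noncomputable def dirac (a : Ω) : Ω → ℝ := fun x => if x = a then 1 else 0

theorem dirac_nonneg (a x : Ω) : 0 ≤ dirac a x := by
  unfold dirac
  positivity

variable [Fintype Ω]

theorem sum_dirac_mul (a : Ω) (f : Ω → ℝ) : ∑ x, dirac a x * f x = f a := by
  classical
  simp [dirac]

theorem isProb_dirac (a : Ω) : IsProb (dirac a) :=
  ⟨dirac_nonneg a, by simpa using sum_dirac_mul a 1⟩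

theorem sum_expect_mul {ι : Type*} [Fintype ι] (μ : ι → Ω → ℝ) (f : Ω → ℝ) :
    ∑ x, (𝔼 i, μ i) x * f x = 𝔼 i, ∑ x, μ i x * f x := by
  simp only [Finset.expect_apply, Finset.expect_mul, Finset.expect_sum_comm]

theorem isProb_expect {ι : Type*} [Fintype ι] [Nonempty ι] {μ : ι → Ω → ℝ}
    (hμ : ∀ i, IsProb (μ i)) : IsProb (𝔼 i, μ i) := by
  refine ⟨fun x => ?_, ?_⟩
  · rw [Finset.expect_apply]
    exact Finset.expect_nonneg fun i _ => (hμ i).1 x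
  · simpa [(hμ _).2] using sum_expect_mul μ 1

open Classical in
/-- The image of the measure `μ` under `f`. -/
noncomputable def pushforward (f : Ω → Ω') (μ : Ω → ℝ) : Ω' → ℝ := fun y => ∑ x with f x = y, μ x

theorem sum_pushforward_mul [Fintype Ω'] (f : Ω → Ω') (μ : Ω → ℝ) (g : Ω' → ℝ) :
    ∑ y, pushforward f μ y * g y = ∑ x, μ x * g (f x) := by
  classical
  rw [← Finset.sum_fiberwise (g := f)]
  refine Finset.sum_congr rfl fun y _ => ?_
  rw [pushforward, Finset.sum_mul]
  exact Finset.sum_congr (by ext; simp) fun x hx => by rw [(Finset.mem_filter.1 hx).2]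

theorem pushforward_dirac (f : Ω → Ω') (a : Ω) : pushforward f (dirac a) = dirac (f a) := by
  classical
  ext y
  simp [pushforward, dirac, eq_comm]

theorem tvDist_pushforward_le (f : Ω → Ω') (μ ν : Ω → ℝ) :
    tvDist (pushforward f μ) (pushforward f ν) ≤ tvDist μ ν := by
  classical
  have hsum (ξ : Ω → ℝ) (A : Finset Ω') :
      ∑ y ∈ A, pushforward f ξ y = ∑ x with f x ∈ A, ξ x := by
    simp only [pushforward]
    convert Finset.sum_fiberwise_eq_sum_filter Finset.univ A f ξ
  refine ciSup_le fun A => ?_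
  rw [hsum, hsum]
  exact abs_sum_sub_sum_le_tvDist μ ν _

theorem pushforward_expect {ι : Type*} [Fintype ι] (f : Ω → Ω') (μ : ι → Ω → ℝ) :
    pushforward f (𝔼 i, μ i) = 𝔼 i, pushforward f (μ i) := by
  ext y
  simp only [pushforward, Finset.expect_apply, Finset.expect_sum_comm]

theorem pushforward_unif {G H : Type*} [Group G] [Group H] [Fintype G] [Fintype H] (φ : G →* H)
    (hφ : Function.Surjective φ) : pushforward φ (unif G) = unif H := by
  classical
  have hconst (y : H) : pushforward φ (unif G) y = pushforward φ (unif G) 1 := by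
    simp only [pushforward, unif, Finset.sum_const]
    rw [MonoidHom.card_fiber_eq_of_mem_range φ (hφ y) (hφ 1)]
  have htotal : ∑ y, pushforward φ (unif G) y = 1 := by
    simpa [(isProb_unif G).2] using sum_pushforward_mul φ (unif G) 1
  ext y
  rw [Finset.sum_congr rfl fun y _ => hconst y, Finset.sum_const, nsmul_eq_mul,
    Finset.card_univ] at htotal
  rw [hconst, unif, eq_div_iff (by positivity), mul_comm, htotal]

end Pushforward

/-! ### Convolution -/

section Convolution

variable {G H ι : Type*} [Group G] [Fintype G] [Group H] [Fintype H]

theorem conv_apply (p q : G → ℝ) (x : G) : conv p q x = ∑ y, p y * q (y⁻¹ * x) := by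
  rw [conv, ← Equiv.sum_comp ((Equiv.inv G).trans (Equiv.mulRight x))]
  exact Finset.sum_congr rfl fun y _ => by simp

theorem sum_conv_mul (p q f : G → ℝ) :
    ∑ x, conv p q x * f x = ∑ y, p y * ∑ z, q z * f (y * z) := by
  simp only [conv_apply, Finset.sum_mul, Finset.mul_sum]
  rw [Finset.sum_comm]
  refine Finset.sum_congr rfl fun y _ => ?_
  rw [← Equiv.sum_comp (Equiv.mulLeft y)]
  simp [mul_assoc]

theorem isProb_conv {p q : G → ℝ} (hp : IsProb p) (hq : IsProb q) : IsProb (conv p q) :=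
  ⟨fun _ => Finset.sum_nonneg fun _ _ => mul_nonneg (hp.1 _) (hq.1 _), by
    simpa [hp.2, hq.2] using sum_conv_mul p q 1⟩

theorem isProb_convPow {p : G → ℝ} (hp : IsProb p) : ∀ k, IsProb (convPow p k)
  | 0 => isProb_dirac 1
  | k + 1 => isProb_conv hp (isProb_convPow hp k)

omit [Fintype G] in
theorem dirac_inv (a x : G) : dirac a x⁻¹ = dirac a⁻¹ x := by
  classical
  exact if_congr inv_eq_iff_eq_inv rfl rfl

theorem dirac_conv (a : G) (q : G → ℝ) (x : G) : conv (dirac a) q x = q (a⁻¹ * x) := by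
  rw [conv_apply, sum_dirac_mul a fun y => q (y⁻¹ * x)]

theorem dirac_conv_dirac (a b : G) : conv (dirac a) (dirac b) = dirac (a * b) := by
  classical
  ext x
  rw [dirac_conv]
  exact if_congr inv_mul_eq_iff_eq_mul rfl rfl

theorem conv_expect_expect {κ : Type*} [Fintype ι] [Fintype κ] (p : ι → G → ℝ) (q : κ → G → ℝ) :
    conv (𝔼 i, p i) (𝔼 j, q j) = 𝔼 i, 𝔼 j, conv (p i) (q j) := by
  ext x
  simp only [conv, Finset.expect_apply, Finset.expect_mul_expect, Finset.expect_sum_comm]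

theorem pushforward_conv (φ : G →* H) (p q : G → ℝ) :
    pushforward φ (conv p q) = conv (pushforward φ p) (pushforward φ q) := by
  classical
  ext y
  have hconv := sum_conv_mul p q fun x => dirac y (φ x)
  rw [conv_apply, sum_pushforward_mul φ p fun z => pushforward φ q (z⁻¹ * y)]
  simpa [pushforward, Finset.sum_filter, dirac, eq_inv_mul_iff_mul_eq] using hconv

/-- The law of the product of independent elements with laws `p i`, for the letters `i` of a
word. -/
noncomputable def convWord (p : ι → G → ℝ) : List ι → G → ℝ
  | [] => dirac 1
  | i :: l => conv (p i) (convWord p l)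

theorem convWord_dirac (t : ι → G) (l : List ι) :
    convWord (fun i => dirac (t i)) l = dirac (l.map t).prod := by
  induction l with
  | nil => rfl
  | cons i l ih => rw [convWord, ih, dirac_conv_dirac, List.map_cons, List.prod_cons]

theorem pushforward_convWord (φ : G →* H) (p : ι → G → ℝ) (l : List ι) :
    pushforward φ (convWord p l) = convWord (fun i => pushforward φ (p i)) l := by
  induction l with
  | nil => exact (pushforward_dirac φ 1).trans (by rw [map_one, convWord])
  | cons i l ih => rw [convWord, pushforward_conv, ih, convWord]

theorem isProb_convWord {p : ι → G → ℝ} (hp : ∀ i, IsProb (p i)) : ∀ l, IsProb (convWord p l)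
  | [] => isProb_dirac 1
  | i :: l => isProb_conv (hp i) (isProb_convWord hp l)

theorem pushforward_convPow (φ : G →* H) (p : G → ℝ) (k : ℕ) :
    pushforward φ (convPow p k) = convPow (pushforward φ p) k := by
  induction k with
  | zero => exact (pushforward_dirac φ 1).trans (by rw [map_one]; rfl)
  | succ k ih => rw [convPow, pushforward_conv, ih, convPow]

theorem expect_word_succ {M : Type*} [AddCommMonoid M] [Module ℚ≥0 M] [Fintype ι] {k : ℕ}
    (f : List ι → M) :
    𝔼 w : Fin (k + 1) → ι, f (List.ofFn w) =
      𝔼 i, 𝔼 w : Fin k → ι, f (i :: List.ofFn w) := by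
  rw [← Finset.expect_product', Finset.univ_product_univ]
  exact (Fintype.expect_equiv (Fin.consEquiv fun _ => ι) _ _ fun w => by simp).symm

theorem convPow_expect [Fintype ι] (p : ι → G → ℝ) (k : ℕ) :
    convPow (𝔼 i, p i) k = 𝔼 w : Fin k → ι, convWord p (List.ofFn w) := by
  induction k with
  | zero => simp only [List.ofFn_zero, Fintype.expect_const]; rfl
  | succ k ih => rw [convPow, ih, conv_expect_expect, expect_word_succ (convWord p)]; rfl

end Convolution

/-! ### Transition matrices -/

section Transition

variable {G : Type*} [Group G] [Fintype G]

theorem transition_mul_transition (p q : G → ℝ) :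
    transition p * transition q = transition (conv p q) := by
  ext x y
  simp only [Matrix.mul_apply, transition, Matrix.of_apply, conv_apply]
  rw [← Equiv.sum_comp (Equiv.mulLeft x)]
  simp [mul_assoc]

theorem transition_pow [DecidableEq G] (p : G → ℝ) (k : ℕ) :
    transition p ^ k = transition (convPow p k) := by
  induction k with
  | zero =>
    ext x y
    simp [transition, convPow, Matrix.one_apply, inv_mul_eq_one]
  | succ k ih => rw [pow_succ', ih, transition_mul_transition, convPow]

theorem exists_convPow_pos {p : G → ℝ} (hp : ∀ x, 0 ≤ p x)
    (hgen : Subgroup.closure (Function.support p) = ⊤) (g : G) : ∃ k, 0 < convPow p k g := by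
  have hconvPow (k : ℕ) (x : G) : 0 ≤ convPow p k x := by
    induction k generalizing x with
    | zero => exact dirac_nonneg 1 x
    | succ k ih => exact Finset.sum_nonneg fun y _ => mul_nonneg (hp _) (ih y)
  have hg : g ∈ Submonoid.closure (Function.support p) := by
    rw [← Subgroup.closure_toSubmonoid_of_finite, hgen]
    trivial
  induction hg using Submonoid.closure_induction_left with
  | one => exact ⟨0, by simp [convPow]⟩
  | mul_left x hx y _ ih =>
    obtain ⟨k, hk⟩ := ih
    refine ⟨k + 1, ?_⟩
    rw [convPow, conv_apply]
    refine Finset.sum_pos' (fun z _ => mul_nonneg (hp z) (hconvPow k _))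
      ⟨x, Finset.mem_univ x, mul_pos ((hp x).lt_of_ne' hx) ?_⟩
    rwa [inv_mul_cancel_left]

theorem isIrred_transition {p : G → ℝ} (hp : ∀ x, 0 ≤ p x)
    (hgen : Subgroup.closure (Function.support p) = ⊤) : IsIrred (transition p) := by
  classical
  intro x y
  obtain ⟨k, hk⟩ := exists_convPow_pos hp hgen (x⁻¹ * y)
  refine ⟨k, ?_⟩
  rw [transition_pow]
  exact hk

theorem isAperiodic_transition {p : G → ℝ} (h1 : 0 < p 1) : IsAperiodic (transition p) := by
  intro x d hd
  refine Nat.dvd_one.1 (hd 1 ⟨le_rfl, ?_⟩)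
  simpa [transition] using h1

omit [Fintype G] in
theorem isHermitian_transition {p : G → ℝ} (hp : ∀ x, p x⁻¹ = p x) :
    (transition p).IsHermitian := by
  ext x y
  simp [transition, ← hp (x⁻¹ * y)]

theorem trace_transition_pow_two_mul [DecidableEq G] {p : G → ℝ}
    (hp : (transition p).IsHermitian) (k : ℕ) :
    (transition p ^ (2 * k)).trace = Fintype.card G * ∑ x, convPow p k x ^ 2 := by
  have hsymm := hp.pow k
  have hrow (x : G) : ∑ y, (transition p ^ k) x y * (transition p ^ k) y x =
      ∑ y, convPow p k y ^ 2 := by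
    rw [Finset.sum_congr rfl fun y _ => by rw [← hsymm.apply y x, star_trivial, ← sq],
      transition_pow, ← Equiv.sum_comp (Equiv.mulLeft x)]
    simp [transition]
  simp [two_mul, pow_add, Matrix.trace, Matrix.mul_apply, hrow]

theorem trace_pow_eq_sum_eigenvalues_pow {𝕜 n : Type*} [RCLike 𝕜] [Fintype n]
    [DecidableEq n] {A : Matrix n n 𝕜} (hA : A.IsHermitian) (k : ℕ) :
    (A ^ k).trace = ∑ i, (hA.eigenvalues i : 𝕜) ^ k := by
  conv_lhs => rw [hA.spectral_theorem, ← map_pow, Matrix.diagonal_pow]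
  rw [Unitary.conjStarAlgAut_apply, Matrix.trace_mul_cycle]
  simp

theorem two_mul_tvDist_convPow_unif_le [DecidableEq G] {p : G → ℝ} (hp : IsProb p)
    (hherm : (transition p).IsHermitian) (k : ℕ) :
    2 * tvDist (convPow p k) (unif G) ≤ √(∑ i, hherm.eigenvalues i ^ (2 * k) - 1) := by
  have hmass := (isProb_convPow hp k).2
  have htrace := trace_pow_eq_sum_eigenvalues_pow hherm (2 * k)
  rw [trace_transition_pow_two_mul hherm] at htrace
  convert two_mul_tvDist_unif_le hmass
  simp only [sub_sq, Finset.sum_add_distrib, Finset.sum_sub_distrib, ← Finset.sum_mul,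
    ← Finset.mul_sum, hmass]
  simp only [RCLike.ofReal_real_eq_id, id] at htrace
  rw [← htrace]
  simp only [mul_one, one_div, inv_pow, Finset.sum_const, Finset.card_univ, nsmul_eq_mul]
  field_simp
  ring

end Transition

/-! ### Jucys–Murphy operators -/

section JucysMurphy

theorem le_of_isSymmetric_of_eigenvectors_mem {𝕜 V : Type*} [RCLike 𝕜] [NormedAddCommGroup V]
    [InnerProductSpace 𝕜 V] {T : V →ₗ[𝕜] V} (hT : T.IsSymmetric) {E K : Submodule 𝕜 V}
    [FiniteDimensional 𝕜 E] (hE : ∀ v ∈ E, T v ∈ E)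
    (hK : ∀ (a : 𝕜), ∀ v ∈ E, T v = a • v → v ∈ K) : E ≤ K := by
  have htop := (hT.restrict_invariant hE).orthogonalComplement_iSup_eigenspaces_eq_bot
  rw [Submodule.orthogonal_eq_bot_iff] at htop
  have hle : (⊤ : Submodule 𝕜 E) ≤ K.comap E.subtype := by
    rw [← htop]
    refine iSup_le fun a v hv => hK a v v.2 ?_
    exact congrArg Subtype.val (Module.End.mem_eigenspace_iff.1 hv)
  exact fun v hv => hle (Submodule.mem_top (x := ⟨v, hv⟩))

theorem map_mul_apply {G V : Type*} [Group G] [NormedAddCommGroup V] [InnerProductSpace ℝ V]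
    {ρ : G →* (V ≃ₗᵢ[ℝ] V)} (σ τ : G) (v : V) : ρ (σ * τ) v = ρ σ (ρ τ v) := by
  rw [map_mul, LinearIsometryEquiv.coe_mul, Function.comp_apply]

variable {α V : Type*} [DecidableEq α] [NormedAddCommGroup V] [InnerProductSpace ℝ V]

/-- The Jucys–Murphy operator `∑_{i ∈ B} (i t)` in an orthogonal representation of the symmetric
group. -/
def jucysMurphy (ρ : Equiv.Perm α →* (V ≃ₗᵢ[ℝ] V)) (B : Finset α) (t : α) : V →ₗ[ℝ] V :=
  ∑ i ∈ B, (ρ (Equiv.swap i t)).toLinearEquiv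

variable {ρ : Equiv.Perm α →* (V ≃ₗᵢ[ℝ] V)} {B : Finset α} {t x : α}

theorem jucysMurphy_apply (ρ : Equiv.Perm α →* (V ≃ₗᵢ[ℝ] V)) (B : Finset α) (t : α) (v : V) :
    jucysMurphy ρ B t v = ∑ i ∈ B, ρ (Equiv.swap i t) v := by
  simp [jucysMurphy]

theorem map_swap_map_swap (i j : α) (v : V) :
    ρ (Equiv.swap i j) (ρ (Equiv.swap i j) v) = v := by
  rw [← map_mul_apply, Equiv.swap_mul_self, map_one, LinearIsometryEquiv.coe_one, id]

theorem jucysMurphy_mem {W : Submodule ℝ V} (hW : ∀ σ, ∀ w ∈ W, ρ σ w ∈ W) (B : Finset α)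
    (t : α) {w : V} (hw : w ∈ W) : jucysMurphy ρ B t w ∈ W := by
  rw [jucysMurphy_apply]
  exact W.sum_mem fun i _ => hW _ _ hw

theorem isSymmetric_jucysMurphy (ρ : Equiv.Perm α →* (V ≃ₗᵢ[ℝ] V)) (B : Finset α) (t : α) :
    (jucysMurphy ρ B t).IsSymmetric := by
  intro v w
  rw [jucysMurphy_apply, jucysMurphy_apply, sum_inner, inner_sum]
  refine Finset.sum_congr rfl fun i _ => ?_
  rw [← LinearIsometryEquiv.inner_map_map (ρ (Equiv.swap i t)) v, map_swap_map_swap]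

theorem norm_jucysMurphy_le (ρ : Equiv.Perm α →* (V ≃ₗᵢ[ℝ] V)) (B : Finset α) (t : α) (v : V) :
    ‖jucysMurphy ρ B t v‖ ≤ B.card * ‖v‖ := by
  rw [jucysMurphy_apply]
  exact (norm_sum_le _ _).trans (by simp)

theorem map_jucysMurphy (σ : Equiv.Perm α) (B : Finset α) (t : α) (v : V) :
    ρ σ (jucysMurphy ρ B t v) = jucysMurphy ρ (B.map σ.toEmbedding) (σ t) (ρ σ v) := by
  simp only [jucysMurphy_apply, map_sum, Finset.sum_map, Equiv.coe_toEmbedding,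
    Equiv.swap_apply_apply, ← map_mul_apply, inv_mul_cancel_right]

theorem jucysMurphy_comm (ht : t ∉ B) (hx : x ∈ B) (v : V) :
    jucysMurphy ρ (B.erase x) x (jucysMurphy ρ B t v) =
      jucysMurphy ρ B t (jucysMurphy ρ (B.erase x) x v) := by
  rw [jucysMurphy_apply (B := B.erase x), jucysMurphy_apply (B := B.erase x), map_sum]
  refine Finset.sum_congr rfl fun i hi => ?_
  have hi := Finset.mem_of_mem_erase hi
  have hB : B.map (Equiv.swap i x).toEmbedding = B := by
    refine Finset.map_perm fun y hy => ?_
    by_contra h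
    exact hy (Equiv.swap_apply_of_ne_of_ne (fun e => h (e ▸ hi)) fun e => h (e ▸ hx))
  have ht : Equiv.swap i x t = t :=
    Equiv.swap_apply_of_ne_of_ne (fun e => ht (e ▸ hi)) fun e => ht (e ▸ hx)
  rw [map_jucysMurphy, hB, ht]

/-- The defining relation of the degenerate affine Hecke algebra. -/
theorem jucysMurphy_erase_map_swap (ht : t ∉ B) (hx : x ∈ B) (v : V) :
    jucysMurphy ρ (B.erase x) x (ρ (Equiv.swap x t) v) =
      ρ (Equiv.swap x t) (jucysMurphy ρ B t v) - v := by
  rw [jucysMurphy_apply, jucysMurphy_apply, ← Finset.add_sum_erase B _ hx, map_add, map_sum,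
    map_swap_map_swap, add_sub_cancel_left]
  refine Finset.sum_congr rfl fun i hi => ?_
  have hi : Equiv.swap x t i = i :=
    Equiv.swap_apply_of_ne_of_ne (Finset.ne_of_mem_erase hi)
      fun e => ht (e ▸ Finset.mem_of_mem_erase hi)
  rw [← map_mul_apply, ← map_mul_apply, Equiv.mul_swap_eq_swap_mul (Equiv.swap x t), hi,
    Equiv.swap_apply_right]

/-- On a joint eigenvector `v` the vector `(x t) v` is, up to a multiple of `v`, an eigenvector of
the smaller operator with the eigenvalue `c` of the larger one. -/
theorem jucysMurphy_erase_map_swap_sub_smul (ht : t ∉ B) (hx : x ∈ B) {a c : ℝ} (hac : a ≠ c)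
    {v : V} (hc : jucysMurphy ρ B t v = c • v) (ha : jucysMurphy ρ (B.erase x) x v = a • v) :
    jucysMurphy ρ (B.erase x) x (ρ (Equiv.swap x t) v - (c - a)⁻¹ • v) =
      c • (ρ (Equiv.swap x t) v - (c - a)⁻¹ • v) := by
  have hac' : c - a ≠ 0 := sub_ne_zero.2 hac.symm
  rw [map_sub, map_smul, jucysMurphy_erase_map_swap ht hx, hc, ha, map_smul]
  match_scalars <;> field_simp
  ring

/-- The bound on the eigenvalues of the smaller operator forces `(x t) v` to be a positive multiple
of `v`, and it has the norm of `v`. -/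
theorem map_swap_eq_of_jucysMurphy_eq_smul {W : Submodule ℝ V} (hW : ∀ σ, ∀ w ∈ W, ρ σ w ∈ W)
    (ht : t ∉ B) (hx : x ∈ B) {a c : ℝ}
    (hB : ∀ b, c ≤ b → ∀ w ∈ W, jucysMurphy ρ (B.erase x) x w = b • w → w = 0)
    {v : V} (hv : v ∈ W) (hc : jucysMurphy ρ B t v = c • v)
    (ha : jucysMurphy ρ (B.erase x) x v = a • v) : ρ (Equiv.swap x t) v = v := by
  rcases le_or_gt c a with hca | hac
  · simp [hB a hca v hv ha]
  have hac' : 0 < (c - a)⁻¹ := inv_pos.2 (sub_pos.2 hac)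
  have hsmul : ρ (Equiv.swap x t) v = (c - a)⁻¹ • v := sub_eq_zero.1 <|
    hB c le_rfl _ (W.sub_mem (hW _ _ hv) (W.smul_mem _ hv))
      (jucysMurphy_erase_map_swap_sub_smul ht hx hac.ne hc ha)
  rcases eq_or_ne v 0 with rfl | hv0
  · simp
  have hnorm : ‖v‖ = (c - a)⁻¹ * ‖v‖ := by
    conv_lhs => rw [← LinearIsometryEquiv.norm_map (ρ (Equiv.swap x t)) v, hsmul, norm_smul,
      Real.norm_of_nonneg hac'.le]
  rw [hsmul, (right_eq_mul₀ (norm_ne_zero_iff.2 hv0)).1 hnorm, one_smul]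

variable [FiniteDimensional ℝ V]

theorem map_swap_eq_of_forall_eigenvector {W : Submodule ℝ V} (hW : ∀ σ, ∀ w ∈ W, ρ σ w ∈ W)
    (ht : t ∉ B) (hx : x ∈ B) {c : ℝ}
    (hB : ∀ b, c ≤ b → ∀ w ∈ W, jucysMurphy ρ (B.erase x) x w = b • w → w = 0)
    {w : V} (hw : w ∈ W) (hc : jucysMurphy ρ B t w = c • w) : ρ (Equiv.swap x t) w = w := by
  let E : Submodule ℝ V := W ⊓ Module.End.eigenspace (jucysMurphy ρ B t) c
  let K : Submodule ℝ V :=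
    LinearMap.eqLocus (ρ (Equiv.swap x t)).toLinearEquiv.toLinearMap LinearMap.id
  have hEK : E ≤ K := by
    refine le_of_isSymmetric_of_eigenvectors_mem (isSymmetric_jucysMurphy ρ (B.erase x) x) ?_ ?_
    · rintro v ⟨hvW, hvc⟩
      refine ⟨jucysMurphy_mem hW _ _ hvW, ?_⟩
      rw [SetLike.mem_coe, Module.End.mem_eigenspace_iff] at hvc ⊢
      rw [← jucysMurphy_comm ht hx, hvc, map_smul]
    · rintro a v ⟨hvW, hvc⟩ hva
      exact map_swap_eq_of_jucysMurphy_eq_smul hW ht hx hB hvW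
        (Module.End.mem_eigenspace_iff.1 hvc) hva
  exact hEK ⟨hw, Module.End.mem_eigenspace_iff.2 hc⟩

theorem eq_zero_of_jucysMurphy_eq_smul {W : Submodule ℝ V} (hW : ∀ σ, ∀ w ∈ W, ρ σ w ∈ W)
    {r : ℕ} (hr : ∀ (C : Finset α) (t : α), t ∉ C → C.card = r →
      ∀ w ∈ W, (∀ x ∈ C, ρ (Equiv.swap x t) w = w) → w = 0)
    (ht : t ∉ B) {c : ℝ} (hc : (r : ℝ) - 1 < c) {w : V} (hw : w ∈ W)
    (h : jucysMurphy ρ B t w = c • w) : w = 0 := by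
  induction B using Finset.strongInduction generalizing t c w with
  | H B ih =>
    rcases lt_or_ge B.card r with hBr | hrB
    · have hBr : (B.card : ℝ) + 1 ≤ r := by exact_mod_cast hBr
      have hnorm := norm_jucysMurphy_le ρ B t w
      have hcard : (0 : ℝ) ≤ B.card := B.card.cast_nonneg
      rw [h, norm_smul, Real.norm_of_nonneg (by linarith)] at hnorm
      by_contra hw0
      linarith [le_of_mul_le_mul_right hnorm (norm_pos_iff.2 hw0)]
    · obtain ⟨C, hCB, hC⟩ := Finset.exists_subset_card_eq hrB
      refine hr C t (fun htC => ht (hCB htC)) hC w hw fun x hxC => ?_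
      have hx := hCB hxC
      exact map_swap_eq_of_forall_eigenvector hW ht hx (fun b hcb v hv hvb =>
        ih _ (Finset.erase_ssubset hx) (Finset.notMem_erase x B) (hc.trans_le hcb) hv hvb) hw h

end JucysMurphy

/-! ### The right regular representation and cylinder functions -/

theorem mem_of_eigenvalue_not_on_orthogonal {V : Type*} [NormedAddCommGroup V]
    [InnerProductSpace ℝ V] [FiniteDimensional ℝ V] {T : V →ₗ[ℝ] V} (hT : T.IsSymmetric)
    {U : Submodule ℝ V} (hU : ∀ w ∈ Uᗮ, T w ∈ Uᗮ) {c : ℝ} (h : ∀ w ∈ Uᗮ, T w = c • w → w = 0)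
    {v : V} (hv : T v = c • v) : v ∈ U := by
  have hle : Uᗮ ≤ (Submodule.span ℝ {v})ᗮ := by
    refine le_of_isSymmetric_of_eigenvectors_mem hT hU fun a w hw hwa => ?_
    rw [Submodule.mem_orthogonal_singleton_iff_inner_left]
    rcases eq_or_ne a c with rfl | hac
    · rw [h w hw hwa, inner_zero_left]
    · have hinner := hT w v
      rw [hwa, hv, real_inner_smul_left, real_inner_smul_right] at hinner
      exact (mul_eq_mul_right_iff.1 hinner).resolve_left hac
  rw [← U.orthogonal_orthogonal]
  exact fun w hw => Submodule.mem_orthogonal_singleton_iff_inner_left.1 (hle hw)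

section RegularRepresentation

variable {G : Type*} [Group G] [Fintype G]

/-- The right regular representation on `ℓ²(G)`. -/
noncomputable def rightRegular (G : Type*) [Group G] [Fintype G] :
    G →* (EuclideanSpace ℝ G ≃ₗᵢ[ℝ] EuclideanSpace ℝ G) where
  toFun σ := LinearIsometryEquiv.piLpCongrLeft 2 ℝ ℝ (Equiv.mulRight σ⁻¹)
  map_one' := by
    ext f x
    exact congrArg f (mul_inv_eq_of_eq_mul (by simp))
  map_mul' σ τ := by
    ext f x
    exact congrArg f (by simp [Equiv.mulRight, mul_assoc])

theorem rightRegular_apply (σ : G) (f : EuclideanSpace ℝ G) (x : G) :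
    rightRegular G σ f x = f (x * σ) := by
  simp [rightRegular, LinearIsometryEquiv.piLpCongrLeft_apply, Equiv.piCongrLeft'_apply]

theorem transition_mulVec_apply (p : G → ℝ) (f : EuclideanSpace ℝ G) (x : G) :
    (transition p).mulVec f x = ∑ z, p z * rightRegular G z f x := by
  simp only [Matrix.mulVec, dotProduct, transition, Matrix.of_apply, rightRegular_apply]
  rw [← Equiv.sum_comp (Equiv.mulLeft x)]
  simp

end RegularRepresentation

section Cylinder

variable {α : Type*}

theorem mem_closure_swap_of_forall_apply_eq [Finite α] [DecidableEq α] {C : Set α} {t : α}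
    (ht : t ∉ C) {σ : Equiv.Perm α} (hσ : ∀ d, d ≠ t → d ∉ C → σ d = d) :
    σ ∈ Subgroup.closure ((Equiv.swap · t) '' C) := by
  set S : Set (Equiv.Perm α) := (Equiv.swap · t) '' C
  have hS : ∀ τ ∈ S, τ.IsSwap := by
    rintro _ ⟨x, hx, rfl⟩
    exact ⟨x, t, fun h => ht (h ▸ hx), rfl⟩
  have horbit : ∀ y ∈ insert t C, MulAction.orbit (Subgroup.closure S) y =
      MulAction.orbit (Subgroup.closure S) t := by
    rintro y (rfl | hy)
    · rfl
    · exact MulAction.orbit_eq_iff.2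
        ⟨⟨Equiv.swap y t, Subgroup.subset_closure ⟨y, hy, rfl⟩⟩, Equiv.swap_apply_right y t⟩
  rw [mem_closure_isSwap hS]
  refine ⟨Set.toFinite _, fun x => MulAction.orbit_eq_iff.1 ?_⟩
  by_cases hx : x ∈ insert t C
  · have hσx : σ x ∈ insert t C := by
      by_contra h
      have hfix := hσ (σ x) (fun e => h (Or.inl e)) fun e => h (Or.inr e)
      exact h (by rwa [σ.injective hfix])
    rw [horbit _ hσx, horbit x hx]
  · rw [hσ x (fun e => hx (Or.inl e)) fun e => hx (Or.inr e)]

variable [Fintype α] [DecidableEq α]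

open Classical in
/-- The indicator function of the permutations whose values at the places `d` are `φ`. -/
noncomputable def cylinder {j : ℕ} (d φ : Fin j → α) : EuclideanSpace ℝ (Equiv.Perm α) :=
  WithLp.toLp 2 fun y => if y ∘ d = φ then 1 else 0

variable (α) in
/-- The functions of a permutation that are combinations of functions of `j` of its values. -/
noncomputable def cylinderSpan (j : ℕ) : Submodule ℝ (EuclideanSpace ℝ (Equiv.Perm α)) :=
  Submodule.span ℝ (Set.range fun p : (Fin j → α) × (Fin j → α) => cylinder p.1 p.2)

theorem finrank_cylinderSpan_le (j : ℕ) :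
    Module.finrank ℝ (cylinderSpan α j) ≤ Fintype.card α ^ (2 * j) :=
  (finrank_range_le_card _).trans (by simp [two_mul, pow_add])

theorem inner_cylinder {j : ℕ} (d φ : Fin j → α) (f : EuclideanSpace ℝ (Equiv.Perm α)) :
    inner ℝ (cylinder d φ) f = ∑ y with ⇑(y : Equiv.Perm α) ∘ d = φ, f y := by
  classical
  simp [cylinder, PiLp.inner_apply, Finset.sum_filter]

theorem rightRegular_cylinder {j : ℕ} (σ : Equiv.Perm α) (d φ : Fin j → α) :
    rightRegular _ σ (cylinder d φ) = cylinder (σ ∘ d) φ := by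
  ext y
  rw [rightRegular_apply]
  rfl

theorem rightRegular_mem_cylinderSpan {j : ℕ} (σ : Equiv.Perm α) :
    ∀ f ∈ cylinderSpan α j, rightRegular _ σ f ∈ cylinderSpan α j := by
  intro f hf
  refine Submodule.span_le (p := (cylinderSpan α j).comap
    (rightRegular _ σ).toLinearEquiv.toLinearMap).2 ?_ hf
  rintro _ ⟨⟨d, φ⟩, rfl⟩
  exact Submodule.subset_span ⟨(σ ∘ d, φ), (rightRegular_cylinder σ d φ).symm⟩

theorem rightRegular_mem_orthogonal_cylinderSpan {j : ℕ} (σ : Equiv.Perm α) :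
    ∀ f ∈ (cylinderSpan α j)ᗮ, rightRegular _ σ f ∈ (cylinderSpan α j)ᗮ := by
  intro f hf u hu
  rw [← LinearIsometryEquiv.inner_map_map (rightRegular _ σ⁻¹), ← map_mul_apply,
    inv_mul_cancel, map_one]
  exact hf _ (rightRegular_mem_cylinderSpan σ⁻¹ u hu)

/-- Fixed vectors are functions of the cosets of the symmetric group on `C ∪ {t}`, that is, of the
values at the remaining `j` points. -/
theorem eq_zero_of_fixed_of_mem_orthogonal {j : ℕ} {C : Finset α} {t : α} (ht : t ∉ C)
    (hC : C.card + 1 + j = Fintype.card α) {f : EuclideanSpace ℝ (Equiv.Perm α)}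
    (hf : f ∈ (cylinderSpan α j)ᗮ) (hfix : ∀ x ∈ C, rightRegular _ (Equiv.swap x t) f = f) :
    f = 0 := by
  have hclosure : ∀ σ ∈ Subgroup.closure ((Equiv.swap · t) '' (C : Set α)),
      rightRegular _ σ f = f := by
    intro σ hσ
    induction hσ using Subgroup.closure_induction with
    | mem σ hσ =>
      obtain ⟨x, hx, rfl⟩ := hσ
      exact hfix x hx
    | one => simp
    | mul σ τ _ _ hσ hτ => rw [map_mul_apply, hτ, hσ]
    | inv σ _ hσ => rw [← hσ, ← map_mul_apply, inv_mul_cancel, map_one, hσ]; rfl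
  have hcard : ((insert t C)ᶜ).card = j := by
    rw [Finset.card_compl, Finset.card_insert_of_notMem ht]
    lia
  let d : Fin j → α := fun i => (Finset.equivFinOfCardEq hcard).symm i
  ext x
  have hconst : ∀ y : Equiv.Perm α, y ∘ d = x ∘ d → f y = f x := by
    intro y hy
    have hmem : x⁻¹ * y ∈ Subgroup.closure ((Equiv.swap · t) '' (C : Set α)) := by
      refine mem_closure_swap_of_forall_apply_eq ht fun a hat haC => ?_
      have ha : a ∈ (insert t C)ᶜ := by simp_all
      have hya := congrFun hy (Finset.equivFinOfCardEq hcard ⟨a, ha⟩)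
      simp only [Function.comp_apply, d, Equiv.symm_apply_apply] at hya
      simp [hya]
    rw [← congrArg (fun g => g x) (hclosure _ hmem), rightRegular_apply, mul_inv_cancel_left]
  have hsum := hf _ (Submodule.subset_span ⟨(d, x ∘ d), rfl⟩)
  rw [inner_cylinder, Finset.sum_congr rfl fun y hy => hconst y (Finset.mem_filter.1 hy).2,
    Finset.sum_const, smul_eq_zero] at hsum
  exact hsum.resolve_left
    (Finset.card_ne_zero_of_mem (Finset.mem_filter.2 ⟨Finset.mem_univ x, rfl⟩))

theorem mem_cylinderSpan_of_jucysMurphy_eq_smul {j : ℕ} (hj : j < Fintype.card α) (t : α) {c : ℝ}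
    (hc : (Fintype.card α : ℝ) - 2 - j < c) {v : EuclideanSpace ℝ (Equiv.Perm α)}
    (hv : jucysMurphy (rightRegular _) (Finset.univ.erase t) t v = c • v) :
    v ∈ cylinderSpan α j := by
  obtain ⟨r, hr⟩ : ∃ r, r + 1 + j = Fintype.card α := ⟨Fintype.card α - 1 - j, by lia⟩
  have hrc : (r : ℝ) - 1 < c := by
    rw [← hr] at hc
    push_cast at hc
    linarith
  have hinv := rightRegular_mem_orthogonal_cylinderSpan (α := α) (j := j)
  refine mem_of_eigenvalue_not_on_orthogonal (isSymmetric_jucysMurphy _ _ t)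
    (fun w hw => jucysMurphy_mem hinv _ _ hw) (fun w hw hwc => ?_) hv
  exact eq_zero_of_jucysMurphy_eq_smul hinv
    (fun C t ht hC w hw hfix => eq_zero_of_fixed_of_mem_orthogonal ht (by rwa [hC]) hw hfix)
    (Finset.notMem_erase t _) hrc hw hwc

theorem card_eigenvalue_gt_le {j : ℕ} (hj : j < Fintype.card α) (t : α) {ι : Type*} [Fintype ι]
    {v : ι → EuclideanSpace ℝ (Equiv.Perm α)} (hli : LinearIndependent ℝ v) {c : ι → ℝ}
    (hv : ∀ i, jucysMurphy (rightRegular _) (Finset.univ.erase t) t (v i) = c i • v i) :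
    Finset.card {i | (Fintype.card α : ℝ) - 2 - j < c i} ≤ Fintype.card α ^ (2 * j) := by
  refine le_trans ?_ (finrank_cylinderSpan_le j)
  have hli := hli.comp (Subtype.val : {i // (Fintype.card α : ℝ) - 2 - j < c i} → ι)
    Subtype.val_injective
  rw [← Fintype.card_subtype, ← finrank_span_eq_card hli]
  refine Submodule.finrank_mono (Submodule.span_le.2 ?_)
  rintro _ ⟨i, rfl⟩
  exact mem_cylinderSpan_of_jucysMurphy_eq_smul hj t i.2 (hv i)

theorem abs_eigenvalue_le (t : α) {c : ℝ} {v : EuclideanSpace ℝ (Equiv.Perm α)} (hv0 : v ≠ 0)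
    (hv : jucysMurphy (rightRegular _) (Finset.univ.erase t) t v = c • v) :
    |c| ≤ (Fintype.card α : ℝ) - 1 := by
  have h := norm_jucysMurphy_le (rightRegular _) (Finset.univ.erase t) t v
  rw [hv, norm_smul, Real.norm_eq_abs, Finset.card_erase_of_mem (Finset.mem_univ t),
    Finset.card_univ, Nat.cast_pred (Fintype.card_pos_iff.2 ⟨t⟩)] at h
  exact le_of_mul_le_mul_right h (norm_pos_iff.2 hv0)

/-- Multiplication by the sign character. It turns an eigenvector of a Jucys–Murphy operator into
one with the opposite eigenvalue. -/
noncomputable def signTwist : EuclideanSpace ℝ (Equiv.Perm α) →ₗ[ℝ]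
    EuclideanSpace ℝ (Equiv.Perm α) where
  toFun f := WithLp.toLp 2 fun x => ((Equiv.Perm.sign x : ℤ) : ℝ) * f x
  map_add' f g := by ext x; simp [mul_add]
  map_smul' a f := by ext x; simp [mul_left_comm]

theorem signTwist_apply (f : EuclideanSpace ℝ (Equiv.Perm α)) (x : Equiv.Perm α) :
    signTwist f x = ((Equiv.Perm.sign x : ℤ) : ℝ) * f x := rfl

theorem signTwist_injective : Function.Injective (signTwist (α := α)) := by
  intro f g h
  ext x
  have hx := congrArg (fun v => v x) h
  rcases Int.units_eq_one_or (Equiv.Perm.sign x) with hsign | hsign <;>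
    simpa [signTwist_apply, hsign] using hx

theorem jucysMurphy_signTwist (t : α) (v : EuclideanSpace ℝ (Equiv.Perm α)) :
    jucysMurphy (rightRegular _) (Finset.univ.erase t) t (signTwist v) =
      -signTwist (jucysMurphy (rightRegular _) (Finset.univ.erase t) t v) := by
  rw [jucysMurphy_apply, jucysMurphy_apply, map_sum, ← Finset.sum_neg_distrib]
  refine Finset.sum_congr rfl fun i hi => ?_
  ext x
  have hit : i ≠ t := Finset.ne_of_mem_erase hi
  simp [rightRegular_apply, signTwist_apply, Equiv.Perm.sign_swap hit]

end Cylinder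

/-! ### The star transposition walk -/

theorem sum_pow_le_of_card_fiber_le {ι : Type*} {s : Finset ι} {d : ι → ℕ} {m x : ℝ} (hx : 0 ≤ x)
    (hmx : m * x < 1) (hcard : ∀ j, (Finset.card {i ∈ s | d i = j} : ℝ) ≤ m ^ j) :
    ∑ i ∈ s, x ^ d i ≤ (1 - m * x)⁻¹ := by
  have hm : 0 ≤ m := by simpa using (Nat.cast_nonneg _).trans (hcard 1)
  have hmx0 : 0 ≤ m * x := mul_nonneg hm hx
  calc ∑ i ∈ s, x ^ d i
      = ∑ j ∈ s.image d, Finset.card {i ∈ s | d i = j} * x ^ j := by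
        simp only [Finset.sum_comp (x ^ ·) d, nsmul_eq_mul]
    _ ≤ ∑ j ∈ s.image d, (m * x) ^ j := by
        refine Finset.sum_le_sum fun j _ => ?_
        rw [mul_pow]
        exact mul_le_mul_of_nonneg_right (hcard j) (pow_nonneg hx j)
    _ ≤ (1 - m * x)⁻¹ := by
        rw [← tsum_geometric_of_lt_one hmx0 hmx]
        exact (summable_geometric_of_lt_one hmx0 hmx).sum_le_tsum _ fun j _ => pow_nonneg hmx0 j

theorem sum_pow_le_of_card_gt_le {ι : Type*} [Fintype ι] {s : Finset ι} {n k : ℕ} {c : ι → ℝ}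
    (hpos : ∀ i ∈ s, -1 < c i) (hle : ∀ i ∈ s, c i ≤ n - 1)
    (hcard : ∀ j < n, Finset.card {i | (n : ℝ) - 2 - j < c i} ≤ n ^ (2 * j))
    (hn : n ^ 2 * Real.exp (-(2 * k / n)) < 1) :
    ∑ i ∈ s, ((c i + 1) / n) ^ (2 * k) ≤ (1 - n ^ 2 * Real.exp (-(2 * k / n)))⁻¹ := by
  let d : ι → ℕ := fun i => ⌊n - 1 - c i⌋₊
  have hd (i) (hi : i ∈ s) : (d i : ℝ) ≤ n - 1 - c i := Nat.floor_le (by linarith [hle i hi])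
  have hdn (i) (hi : i ∈ s) : d i < n := by
    have hlt : (d i : ℝ) < n := by linarith [hd i hi, hpos i hi]
    exact_mod_cast hlt
  have hterm (i) (hi : i ∈ s) : ((c i + 1) / n) ^ (2 * k) ≤ Real.exp (-(2 * k / n)) ^ d i := by
    have hn0 : (0 : ℝ) < n := by exact_mod_cast (Nat.zero_le _).trans_lt (hdn i hi)
    have hbase : (c i + 1) / n ≤ Real.exp (-(d i / n)) := by
      refine le_trans ?_ (Real.one_sub_le_exp_neg _)
      rw [div_le_iff₀ hn0, sub_mul, div_mul_cancel₀ _ hn0.ne']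
      linarith [hd i hi]
    refine (pow_le_pow_left₀ (div_nonneg (by linarith [hpos i hi]) hn0.le) hbase _).trans_eq ?_
    rw [← Real.exp_nat_mul, ← Real.exp_nat_mul]
    push_cast
    ring_nf
  refine (Finset.sum_le_sum hterm).trans
    (sum_pow_le_of_card_fiber_le (Real.exp_pos _).le hn fun j => ?_)
  rcases lt_or_ge j n with hj | hj
  · rw [← pow_mul, ← Nat.cast_pow, Nat.cast_le]
    refine (Finset.card_le_card fun i hi => ?_).trans (hcard j hj)
    obtain ⟨-, rfl⟩ := Finset.mem_filter.1 hi
    exact Finset.mem_filter.2 ⟨Finset.mem_univ i, by linarith [Nat.lt_floor_add_one (n - 1 - c i)]⟩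
  · rw [Finset.filter_false_of_mem fun i hi => ((hdn i hi).trans_le hj).ne, Finset.card_empty,
      Nat.cast_zero]
    positivity

theorem sub_two_div_pow_le {a n : ℝ} (hn : 0 < n) (ha : 2 / n ≤ a) (ha1 : a ≤ 1) (k : ℕ) :
    (a - 2 / n) ^ (2 * k) ≤ a ^ (2 * k) * Real.exp (-(2 * k / n)) ^ 2 := by
  have hn2 : 0 < 2 / n := by positivity
  have hle : a - 2 / n ≤ a * Real.exp (-(2 / n)) := by
    have hexp := mul_le_mul_of_nonneg_left (Real.one_sub_le_exp_neg (2 / n)) (hn2.le.trans ha)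
    linarith [mul_le_mul_of_nonneg_right ha1 hn2.le]
  refine (pow_le_pow_left₀ (sub_nonneg.2 ha) hle _).trans_eq ?_
  rw [mul_pow, ← Real.exp_nat_mul, ← Real.exp_nat_mul]
  push_cast
  ring_nf

variable {α : Type*} [Fintype α] [DecidableEq α]

/-- The law of a transposition of `t` with a uniformly chosen point (of the identity, when that
point is `t`). -/
noncomputable def starTransposition (t : α) : Equiv.Perm α → ℝ :=
  𝔼 i, dirac (Equiv.swap i t)

theorem isProb_starTransposition (t : α) : IsProb (starTransposition t) :=
  have : Nonempty α := ⟨t⟩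
  isProb_expect fun _ => isProb_dirac _

theorem isHermitian_transition_starTransposition (t : α) :
    (transition (starTransposition t)).IsHermitian := by
  refine isHermitian_transition fun σ => ?_
  simp only [starTransposition, Finset.expect_apply]
  exact Finset.expect_congr rfl fun i _ => by rw [dirac_inv, Equiv.swap_inv]

theorem jucysMurphy_eq_transition_mulVec (t : α) (f : EuclideanSpace ℝ (Equiv.Perm α)) :
    jucysMurphy (rightRegular _) (Finset.univ.erase t) t f =
      (Fintype.card α : ℝ) • WithLp.toLp 2 ((transition (starTransposition t)).mulVec f) - f := by
  have hsum : jucysMurphy (rightRegular _) (Finset.univ.erase t) t f =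
      ∑ i, rightRegular _ (Equiv.swap i t) f - f := by
    rw [jucysMurphy_apply, ← Finset.sum_erase_add _ _ (Finset.mem_univ t), Equiv.swap_self,
      ← Equiv.Perm.one_def, map_one, LinearIsometryEquiv.coe_one, id, add_sub_cancel_right]
  rw [hsum]
  congr 1
  ext x
  change _ = (Fintype.card α : ℝ) • (transition (starTransposition t)).mulVec f x
  rw [transition_mulVec_apply, starTransposition, sum_expect_mul, smul_eq_mul,
    Fintype.card_mul_expect]
  simp [sum_dirac_mul _ fun z => rightRegular _ z f x]

section Eigenvalues

variable {t : α} (hherm : (transition (starTransposition t)).IsHermitian)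

theorem jucysMurphy_eigenvectorBasis (i : Equiv.Perm α) :
    jucysMurphy (rightRegular _) (Finset.univ.erase t) t (hherm.eigenvectorBasis i) =
      (Fintype.card α * hherm.eigenvalues i - 1) • hherm.eigenvectorBasis i := by
  rw [jucysMurphy_eq_transition_mulVec, hherm.mulVec_eigenvectorBasis, sub_smul, one_smul,
    mul_smul]
  rfl

theorem abs_card_mul_eigenvalue_sub_one_le (i : Equiv.Perm α) :
    |Fintype.card α * hherm.eigenvalues i - 1| ≤ Fintype.card α - 1 :=
  abs_eigenvalue_le t (hherm.eigenvectorBasis.orthonormal.ne_zero i)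
    (jucysMurphy_eigenvectorBasis hherm i)

theorem sum_pos_eigenvalues_pow_le {k : ℕ}
    (hk : Fintype.card α ^ 2 * Real.exp (-(2 * k / Fintype.card α)) < 1) :
    ∑ i with 0 < hherm.eigenvalues i, hherm.eigenvalues i ^ (2 * k) ≤
      (1 - Fintype.card α ^ 2 * Real.exp (-(2 * k / Fintype.card α)))⁻¹ := by
  have hn : (0 : ℝ) < Fintype.card α := by exact_mod_cast Fintype.card_pos_iff.2 ⟨t⟩
  refine le_trans (Finset.sum_le_sum fun i _ => ?_) (sum_pow_le_of_card_gt_le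
    (c := fun i => Fintype.card α * hherm.eigenvalues i - 1) (fun i hi => ?_)
    (fun i _ => (abs_le.1 (abs_card_mul_eigenvalue_sub_one_le hherm i)).2)
    (fun j hj => card_eigenvalue_gt_le hj t hherm.eigenvectorBasis.orthonormal.linearIndependent
      (jucysMurphy_eigenvectorBasis hherm)) hk)
  · rw [sub_add_cancel, mul_div_cancel_left₀ _ hn.ne']
  · linarith [mul_pos hn (Finset.mem_filter.1 hi).2]

/-- The sign twist turns a negative eigenvalue `-μ` into `μ + 2 / n`, so that there is a gap of
`2 / n` to gain from. -/
theorem sum_neg_eigenvalues_pow_le {k : ℕ}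
    (hk : Fintype.card α ^ 2 * Real.exp (-(2 * k / Fintype.card α)) < 1) :
    ∑ i with hherm.eigenvalues i < 0, hherm.eigenvalues i ^ (2 * k) ≤
      (1 - Fintype.card α ^ 2 * Real.exp (-(2 * k / Fintype.card α)))⁻¹ *
        Real.exp (-(2 * k / Fintype.card α)) ^ 2 := by
  have hn : (0 : ℝ) < Fintype.card α := by exact_mod_cast Fintype.card_pos_iff.2 ⟨t⟩
  have hc (i) := abs_le.1 (abs_card_mul_eigenvalue_sub_one_le hherm i)
  have hsum := sum_pow_le_of_card_gt_le (s := {i | hherm.eigenvalues i < 0})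
    (c := fun i => -(Fintype.card α * hherm.eigenvalues i - 1))
    (fun i hi => by linarith [mul_neg_of_pos_of_neg hn (Finset.mem_filter.1 hi).2])
    (fun i _ => by linarith [(hc i).1])
    (fun j hj => card_eigenvalue_gt_le hj t
      (hherm.eigenvectorBasis.orthonormal.linearIndependent.map' signTwist
        (LinearMap.ker_eq_bot.2 signTwist_injective))
      fun i => by simp [jucysMurphy_signTwist, jucysMurphy_eigenvectorBasis, -neg_sub]) hk
  refine le_trans ?_ (mul_le_mul_of_nonneg_right hsum (by positivity))
  rw [Finset.sum_mul]
  refine Finset.sum_le_sum fun i hi => ?_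
  have hneg := (Finset.mem_filter.1 hi).2
  set a := (-(Fintype.card α * hherm.eigenvalues i - 1) + 1) / Fintype.card α with ha
  have hai : -hherm.eigenvalues i = a - 2 / Fintype.card α := by
    rw [ha]
    field_simp
    ring
  rw [← (even_two_mul k).neg_pow, hai]
  exact sub_two_div_pow_le hn (by linarith) ((div_le_one hn).2 (by linarith [(hc i).1])) k

theorem sum_eigenvalues_pow_le {k : ℕ}
    (hk : Fintype.card α ^ 2 * Real.exp (-(2 * k / Fintype.card α)) < 1) :
    ∑ i, hherm.eigenvalues i ^ (2 * k) ≤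
      (1 - Fintype.card α ^ 2 * Real.exp (-(2 * k / Fintype.card α)))⁻¹ *
        (1 + Real.exp (-(2 * k / Fintype.card α)) ^ 2) := by
  have hk0 : 2 * k ≠ 0 := by
    rintro h0
    obtain rfl : k = 0 := by lia
    have hn : (1 : ℝ) ≤ Fintype.card α := by exact_mod_cast Fintype.card_pos_iff.2 ⟨t⟩
    simp only [Nat.cast_zero, mul_zero, zero_div, neg_zero, Real.exp_zero, mul_one] at hk
    linarith [one_le_pow₀ hn (n := 2)]
  rw [mul_one_add]
  refine le_of_eq_of_le ?_
    (add_le_add (sum_pos_eigenvalues_pow_le hherm hk) (sum_neg_eigenvalues_pow_le hherm hk))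
  rw [Finset.sum_filter, Finset.sum_filter, ← Finset.sum_add_distrib]
  refine Finset.sum_congr rfl fun i _ => ?_
  rcases lt_trichotomy (hherm.eigenvalues i) 0 with h | h | h
  · simp [h, h.not_gt]
  · simp [h, hk0]
  · simp [h, h.not_gt]

end Eigenvalues

theorem tvDist_convPow_starTransposition_le (t : α) (k : ℕ) :
    tvDist (convPow (starTransposition t) k) (unif (Equiv.Perm α)) ≤
      2 * (Fintype.card α * Real.exp (-(k / Fintype.card α))) := by
  have hprob := isProb_starTransposition t
  have hherm := isHermitian_transition_starTransposition t
  have hn : (1 : ℝ) ≤ Fintype.card α := by exact_mod_cast Fintype.card_pos_iff.2 ⟨t⟩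
  set r := Fintype.card α * Real.exp (-(k / Fintype.card α)) with hr
  have hr0 : 0 < r := by positivity
  rcases le_or_gt (1 / 2) r with hlarge | hsmall
  · exact (tvDist_le_one (isProb_convPow hprob k) (isProb_unif _)).trans (by linarith)
  set x := Real.exp (-(2 * k / Fintype.card α)) with hx
  have hx0 : 0 < x := Real.exp_pos _
  have hrx : Fintype.card α ^ 2 * x = r ^ 2 := by
    rw [hr, hx, mul_pow, ← Real.exp_nat_mul]
    push_cast
    ring_nf
  have hr2 : r ^ 2 < 1 / 4 := by nlinarith
  have hx2 : x ^ 2 ≤ r ^ 2 :=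
    (pow_le_of_le_one hx0.le (Real.exp_le_one_iff.2 (neg_nonpos.2 (by positivity)))
      two_ne_zero).trans (hrx ▸ le_mul_of_one_le_left hx0.le (one_le_pow₀ hn))
  have hsum := sum_eigenvalues_pow_le hherm (k := k) (by rw [← hx, hrx]; linarith)
  rw [← hx, hrx] at hsum
  have hbound : (1 - r ^ 2)⁻¹ * (1 + x ^ 2) - 1 ≤ (2 * r) ^ 2 := by
    rw [inv_mul_eq_div, sub_le_iff_le_add, div_le_iff₀ (by linarith)]
    nlinarith [sq_nonneg r]
  have htv := (two_mul_tvDist_convPow_unif_le hprob hherm k).trans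
    (Real.sqrt_le_sqrt ((sub_le_sub_right hsum 1).trans hbound))
  rw [Real.sqrt_sq (by positivity)] at htv
  linarith

/-! ### Words of random places -/

section Words

variable {ι : Type*} [Fintype ι] [DecidableEq ι]

theorem expect_notMem [Nonempty ι] (S : Finset ι) :
    𝔼 i, (if i ∉ S then (1 : ℝ) else 0) = 1 - S.card / Fintype.card ι := by
  rw [Fintype.expect_eq_sum_div_card, Finset.sum_boole, ← Finset.sdiff_eq_filter,
    ← Finset.compl_eq_univ_sdiff, Finset.card_compl, Nat.cast_sub (Finset.card_le_univ S),
    sub_div, div_self (Nat.cast_ne_zero.2 Fintype.card_ne_zero)]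

theorem expect_forall_notMem [Nonempty ι] (S : Finset ι) (k : ℕ) :
    𝔼 w : Fin k → ι, (if ∀ j ∈ S, j ∉ List.ofFn w then (1 : ℝ) else 0) =
      (1 - S.card / Fintype.card ι) ^ k := by
  have hcons (i : ι) (l : List ι) : (if ∀ j ∈ S, j ∉ i :: l then (1 : ℝ) else 0) =
      (if i ∉ S then 1 else 0) * if ∀ j ∈ S, j ∉ l then 1 else 0 := by
    rw [ite_zero_mul_ite_zero, one_mul]
    refine if_congr ?_ rfl rfl
    simp only [List.mem_cons, not_or, forall_and]
    exact and_congr_left' ⟨fun h hi => h i hi rfl, fun h j hj e => h (e ▸ hj)⟩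
  induction k with
  | zero => simp
  | succ k ih =>
    rw [expect_word_succ fun l => if ∀ j ∈ S, j ∉ l then (1 : ℝ) else 0]
    simp only [hcons]
    rw [← Finset.expect_mul_expect, expect_notMem, ih, pow_succ']

theorem expect_card_filter_notMem [Nonempty ι] (B : Finset ι) (k : ℕ) :
    𝔼 w : Fin k → ι, (Finset.card {j ∈ B | j ∉ List.ofFn w} : ℝ) =
      B.card * (1 - 1 / Fintype.card ι) ^ k := by
  have hletter (j : ι) : 𝔼 w : Fin k → ι, (if j ∉ List.ofFn w then (1 : ℝ) else 0) =
      (1 - 1 / Fintype.card ι) ^ k := by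
    simpa using expect_forall_notMem {j} k
  simp only [← Finset.sum_boole, Finset.expect_sum_comm, hletter, Finset.sum_const, nsmul_eq_mul]

theorem expect_card_filter_notMem_sq_le [Nonempty ι] (B : Finset ι) (k : ℕ) :
    𝔼 w : Fin k → ι, (Finset.card {j ∈ B | j ∉ List.ofFn w} : ℝ) ^ 2 ≤
      B.card * (1 - 1 / Fintype.card ι) ^ k + (B.card * (1 - 1 / Fintype.card ι) ^ k) ^ 2 := by
  set n := (Fintype.card ι : ℝ) with hn
  have hpair (i j : ι) : 𝔼 w : Fin k → ι, ((if i ∉ List.ofFn w then (1 : ℝ) else 0) *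
      if j ∉ List.ofFn w then 1 else 0) ≤
        (if i = j then (1 - 1 / n) ^ k else 0) + ((1 - 1 / n) ^ k) ^ 2 := by
    have hcount := expect_forall_notMem {i, j} k
    simp only [Finset.mem_insert, Finset.mem_singleton, forall_eq_or_imp, forall_eq, ← hn]
      at hcount
    simp only [ite_zero_mul_ite_zero, mul_one, hcount]
    split_ifs with hij
    · simp [hij, sq_nonneg]
    · have h2 : 2 ≤ n := by
        rw [hn, ← Finset.card_univ, ← Nat.cast_two, Nat.cast_le, ← Finset.card_pair hij]
        exact Finset.card_le_univ _
      rw [Finset.card_pair hij, zero_add, ← pow_mul, mul_comm k, pow_mul, Nat.cast_two]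
      refine pow_le_pow_left₀ (sub_nonneg.2 ((div_le_one (by linarith)).2 h2)) ?_ k
      have := sq_nonneg (1 / n)
      linear_combination this
  simp only [← Finset.sum_boole, sq (Finset.sum _ _), Finset.sum_mul_sum, Finset.expect_sum_comm]
  refine (Finset.sum_le_sum fun i _ => Finset.sum_le_sum fun j _ => hpair i j).trans_eq ?_
  simp only [one_div, Finset.sum_add_distrib, Finset.sum_ite_eq, Finset.sum_const, nsmul_eq_mul,
    Finset.sum_ite_mem, Finset.inter_self, add_right_inj]
  ring

/-- The places whose entry has been randomised, when the letters of the word are used from the last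
one to the first. The entry at `t` becomes uniform when `t` is used, and from then on each step
makes the entry at its place uniform. -/
def active (t : ι) : List ι → Finset ι
  | [] => ∅
  | i :: l => if i = t ∨ t ∈ active t l then insert i (active t l) else ∅

omit [Fintype ι] in
theorem mem_active_self_iff {t : ι} {l : List ι} : t ∈ active t l ↔ t ∈ l := by
  induction l with
  | nil => simp [active]
  | cons i l ih =>
    rw [active, List.mem_cons, ← ih]
    split_ifs with h <;> grind

omit [Fintype ι] in
theorem active_eq_empty {t : ι} {l : List ι} (h : t ∉ active t l) : active t l = ∅ := by
  cases l with
  | nil => rfl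
  | cons i l =>
    rw [active] at h ⊢
    split_ifs at h ⊢ with hi
    · grind
    · rfl

theorem expect_notMem_active_cons_le (t j : ι) (l : List ι) :
    𝔼 i, (if j ∉ active t (i :: l) then (1 : ℝ) else 0) ≤
      (1 - 1 / Fintype.card ι) * (if j ∉ active t l then 1 else 0) +
        1 / Fintype.card ι * if t ∉ active t l then 1 else 0 := by
  have : Nonempty ι := ⟨t⟩
  by_cases ht : t ∈ active t l
  · have hinsert (i : ι) : (if j ∉ active t (i :: l) then (1 : ℝ) else 0) =
        (if i ∉ ({j} : Finset ι) then 1 else 0) * if j ∉ active t l then 1 else 0 := by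
      rw [active, if_pos (Or.inr ht), ite_zero_mul_ite_zero, one_mul]
      exact if_congr (by grind) rfl rfl
    simp only [hinsert, ← Finset.expect_mul, expect_notMem, Finset.card_singleton, Nat.cast_one,
      ht, not_true_eq_false, if_false, mul_zero, add_zero, le_refl]
  · have hj : j ∉ active t l := by simp [active_eq_empty ht]
    rw [if_pos ht, if_pos hj, mul_one, mul_one, sub_add_cancel,
      ← Fintype.expect_const (ι := ι) (1 : ℝ)]
    exact Finset.expect_le_expect fun i _ => by split_ifs <;> norm_num

theorem expect_self_notMem_active_le (t : ι) (k : ℕ) :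
    𝔼 w : Fin k → ι, (if t ∉ active t (List.ofFn w) then (1 : ℝ) else 0) ≤
      Real.exp (-(k / Fintype.card ι)) := by
  have : Nonempty ι := ⟨t⟩
  have hn : (1 : ℝ) ≤ Fintype.card ι := by exact_mod_cast Fintype.card_pos_iff.2 ⟨t⟩
  have hcount := expect_forall_notMem {t} k
  simp only [Finset.mem_singleton, forall_eq, Finset.card_singleton, Nat.cast_one] at hcount
  simp only [mem_active_self_iff, hcount]
  refine (pow_le_pow_left₀ (sub_nonneg.2 ((div_le_one (by linarith)).2 hn))
    (Real.one_sub_le_exp_neg _) k).trans_eq ?_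
  rw [← Real.exp_nat_mul]
  ring_nf

theorem expect_notMem_active_le (t j : ι) (k : ℕ) :
    𝔼 w : Fin k → ι, (if j ∉ active t (List.ofFn w) then (1 : ℝ) else 0) ≤
      (1 + Real.exp 1 * k / Fintype.card ι) * Real.exp (-(k / Fintype.card ι)) := by
  have : Nonempty ι := ⟨t⟩
  have hn : (1 : ℝ) ≤ Fintype.card ι := by exact_mod_cast Fintype.card_pos_iff.2 ⟨t⟩
  set n := (Fintype.card ι : ℝ)
  have hn0 : 0 < n := by linarith
  induction k with
  | zero => simp [active]
  | succ k ih =>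
    rw [expect_word_succ fun l => if j ∉ active t l then (1 : ℝ) else 0, Finset.expect_comm]
    refine (Finset.expect_le_expect fun w _ =>
      expect_notMem_active_cons_le t j (List.ofFn w)).trans ?_
    rw [Finset.expect_add_distrib, ← Finset.mul_expect, ← Finset.mul_expect]
    have hstep : Real.exp (-((k + 1 : ℕ) / n)) = Real.exp (-(1 / n)) * Real.exp (-(k / n)) := by
      rw [← Real.exp_add]
      push_cast
      ring_nf
    have hexp : 1 ≤ Real.exp 1 * Real.exp (-(1 / n)) := by
      rw [← Real.exp_add]
      exact Real.one_le_exp (by linarith [(div_le_one hn0).2 hn])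
    have hq := mul_le_mul (Real.one_sub_le_exp_neg (1 / n)) ih
      (Finset.expect_nonneg fun w _ => by positivity) (by positivity)
    have hb := mul_le_mul_of_nonneg_left (expect_self_notMem_active_le t k)
      (show 0 ≤ 1 / n by positivity)
    refine (add_le_add hq hb).trans ?_
    rw [hstep, Nat.cast_add_one]
    have hexp' := mul_le_mul_of_nonneg_right hexp
      (show 0 ≤ 1 / n * Real.exp (-(k / n)) by positivity)
    linear_combination hexp'

theorem expect_active_ne_univ_le (t : ι) (k : ℕ) :
    𝔼 w : Fin k → ι, (if active t (List.ofFn w) ≠ Finset.univ then (1 : ℝ) else 0) ≤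
      (Fintype.card ι + Real.exp 1 * k) * Real.exp (-(k / Fintype.card ι)) := by
  have hunion (l : List ι) : (if active t l ≠ Finset.univ then (1 : ℝ) else 0) ≤
      ∑ j, if j ∉ active t l then (1 : ℝ) else 0 := by
    split_ifs with h
    · obtain ⟨j, hj⟩ := by simpa [Finset.eq_univ_iff_forall] using h
      exact (if_pos hj).symm.trans_le (Finset.single_le_sum (f := fun j =>
        if j ∉ active t l then (1 : ℝ) else 0) (fun i _ => by positivity) (Finset.mem_univ j))
    · positivity
  have : Nonempty ι := ⟨t⟩
  have hn : (Fintype.card ι : ℝ) ≠ 0 := Nat.cast_ne_zero.2 Fintype.card_ne_zero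
  refine (Finset.expect_le_expect fun w _ => hunion (List.ofFn w)).trans ?_
  rw [Finset.expect_sum_comm]
  refine (Finset.sum_le_sum fun j _ => expect_notMem_active_le t j k).trans_eq ?_
  rw [Finset.sum_const, nsmul_eq_mul, Finset.card_univ, ← mul_assoc, mul_one_add,
    mul_div_cancel₀ _ hn]

end Words

end RandomWalk

namespace Monomial

open RandomWalk

/-! ### The increments of the shuffle -/

section Step

variable {G : Type*} [Group G] {n : ℕ} [NeZero n]

/-- The increment of the shuffle that picks the place `i` and the group element `a`. -/
def step (i : Fin n) (a : G) : Monomial G n := if i = ⊤ then lastElt a else warpElt i a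

theorem step_right (i : Fin n) (a : G) : (step i a).right = Equiv.swap i ⊤ := by
  unfold step
  split_ifs with h
  · rw [h, Equiv.swap_self]
    rfl
  · rfl

theorem step_left_top (i : Fin n) (a : G) : (step i a).left ⊤ = a := by
  unfold step
  split_ifs with h
  · simp [lastElt]
  · simp [warpElt, Ne.symm h]

theorem step_injective : Function.Injective fun q : Fin n × G => step q.1 q.2 := by
  rintro ⟨i, a⟩ ⟨j, b⟩ h
  have hplace := congrArg (fun x : Monomial G n => x.right ⊤) h
  have helt := congrArg (fun x : Monomial G n => x.left ⊤) h
  simp only [step_right, Equiv.swap_apply_right] at hplace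
  simp only [step_left_top] at helt
  rw [hplace, helt]

theorem step_top_inv_mul (a : G) (z : Fin n → G) (π : Equiv.Perm (Fin n)) :
    (step ⊤ a)⁻¹ * (⟨z, π⟩ : Monomial G n) = ⟨Function.update z ⊤ (a⁻¹ * z ⊤), π⟩ := by
  rw [step, if_pos rfl, inv_mul_eq_iff_eq_mul, lastElt, mul_eq, one_mul]
  congr 1
  ext j
  rw [inv_one, Equiv.Perm.one_apply]
  rcases eq_or_ne j ⊤ with rfl | hj
  · simp
  · simp [hj]

theorem step_inv_mul {i : Fin n} (hi : i ≠ ⊤) (a : G) (z : Fin n → G)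
    (π : Equiv.Perm (Fin n)) :
    (step i a)⁻¹ * (⟨z, π⟩ : Monomial G n) =
      ⟨Function.update (Function.update z i (a⁻¹ * z ⊤)) ⊤ (a * z i), Equiv.swap i ⊤ * π⟩ := by
  rw [step, if_neg hi, inv_mul_eq_iff_eq_mul, warpElt, mul_eq, Equiv.swap_mul_self_mul]
  congr 1
  ext j
  rcases eq_or_ne j ⊤ with rfl | hj
  · simp [hi, hi.symm]
  rcases eq_or_ne j i with rfl | hji
  · simp [hj]
  · simp [hj, hji, Equiv.swap_apply_of_ne_of_ne hji hj]

open Classical in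
theorem warpTranspose_apply [Fintype G] (x : Monomial G n) :
    warpTranspose G n x =
      if ∃ q : Fin n × G, step q.1 q.2 = x then 1 / ((n : ℝ) * Fintype.card G) else 0 := by
  refine if_congr ⟨?_, ?_⟩ rfl rfl
  · rintro (⟨g, rfl⟩ | ⟨i, hi, g, rfl⟩)
    · exact ⟨(⊤, g), if_pos rfl⟩
    · exact ⟨(i, g), if_neg hi.ne⟩
  · rintro ⟨⟨i, g⟩, rfl⟩
    rcases eq_or_ne i ⊤ with rfl | hi
    · exact Or.inl ⟨g, if_pos rfl⟩
    · exact Or.inr ⟨i, lt_top_iff_ne_top.2 hi, g, if_neg hi⟩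

end Step

section Law

variable {G : Type*} [Group G] [Fintype G] {n : ℕ}

theorem sum_eq_sum_sum (f : Monomial G n → ℝ) :
    ∑ x, f x = ∑ π : Equiv.Perm (Fin n), ∑ z : Fin n → G, f ⟨z, π⟩ := by
  rw [← Equiv.sum_comp SemidirectProduct.equivProd.symm f, Fintype.sum_prod_type, Finset.sum_comm]
  rfl

theorem pushforward_rightHom_apply (μ : Monomial G n → ℝ) (π : Equiv.Perm (Fin n)) :
    pushforward SemidirectProduct.rightHom μ π = ∑ z : Fin n → G, μ ⟨z, π⟩ := by
  classical
  rw [pushforward, Finset.sum_filter, sum_eq_sum_sum, Finset.sum_comm]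
  simp

/-- The law of an element with independent uniform entries in `G` and an independent permutation
with law `μ`. -/
noncomputable def uniformEntries (G : Type*) [Group G] [Fintype G] {n : ℕ}
    (μ : Equiv.Perm (Fin n) → ℝ) : Monomial G n → ℝ :=
  fun x => μ x.right / (Fintype.card G : ℝ) ^ n

theorem sum_uniformEntries (μ : Equiv.Perm (Fin n) → ℝ) :
    ∑ x, uniformEntries G μ x = ∑ π, μ π := by
  rw [sum_eq_sum_sum]
  refine Finset.sum_congr rfl fun π _ => ?_
  simp only [uniformEntries]
  rw [Finset.sum_const, Finset.card_univ, Fintype.card_fun, Fintype.card_fin,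
    nsmul_eq_mul, Nat.cast_pow, mul_div_cancel₀ _ (by positivity)]

theorem isProb_uniformEntries {μ : Equiv.Perm (Fin n) → ℝ} (hμ : IsProb μ) :
    IsProb (uniformEntries G μ) :=
  ⟨fun _ => div_nonneg (hμ.1 _) (by positivity), (sum_uniformEntries μ).trans hμ.2⟩

theorem uniformEntries_unif : uniformEntries G (unif (Equiv.Perm (Fin n))) = unif _ := by
  ext x
  have hcard : Fintype.card (Monomial G n) = Fintype.card ((Fin n → G) × Equiv.Perm (Fin n)) :=
    Fintype.card_congr SemidirectProduct.equivProd
  rw [Fintype.card_prod, Fintype.card_fun, Fintype.card_fin] at hcard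
  rw [uniformEntries, unif, unif, hcard, div_div, mul_comm, Nat.cast_mul, Nat.cast_pow]

theorem uniformEntries_expect {ι : Type*} [Fintype ι] (μ : ι → Equiv.Perm (Fin n) → ℝ) :
    uniformEntries G (𝔼 i, μ i) = 𝔼 i, uniformEntries G (μ i) := by
  ext x
  simp only [uniformEntries, Finset.expect_apply, Finset.expect_div]

theorem tvDist_uniformEntries {μ ν : Equiv.Perm (Fin n) → ℝ} (h : ∑ π, μ π = ∑ π, ν π) :
    tvDist (uniformEntries G μ) (uniformEntries G ν) = tvDist μ ν := by
  have hdiff (x : Monomial G n) : |uniformEntries G μ x - uniformEntries G ν x| =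
      uniformEntries G (fun π => |μ π - ν π|) x := by
    rw [uniformEntries, uniformEntries, ← sub_div, abs_div, uniformEntries,
      abs_of_nonneg (show 0 ≤ (Fintype.card G : ℝ) ^ n by positivity)]
  have hG := two_mul_tvDist (μ := uniformEntries G μ) (ν := uniformEntries G ν)
    (by simp only [sum_uniformEntries, h])
  rw [Finset.sum_congr rfl fun x _ => hdiff x, sum_uniformEntries, ← two_mul_tvDist h] at hG
  exact mul_left_cancel₀ two_ne_zero hG

variable [NeZero n]

/-- The law of the increment of the shuffle, given its place. -/
noncomputable def placeLaw (i : Fin n) : Monomial G n → ℝ := 𝔼 a, dirac (step i a)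

theorem isProb_placeLaw (i : Fin n) : IsProb (placeLaw i : Monomial G n → ℝ) :=
  isProb_expect fun _ => isProb_dirac _

theorem placeLaw_conv (i : Fin n) (q : Monomial G n → ℝ) (x : Monomial G n) :
    conv (placeLaw i) q x = 𝔼 a, q ((step i a)⁻¹ * x) := by
  rw [conv_apply, placeLaw, sum_expect_mul (fun a => dirac (step i a)) fun y => q (y⁻¹ * x)]
  simp only [sum_dirac_mul _ fun y => q (y⁻¹ * x)]

theorem pushforward_placeLaw (i : Fin n) :
    pushforward SemidirectProduct.rightHom (placeLaw i : Monomial G n → ℝ) =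
      dirac (Equiv.swap i ⊤) := by
  simp only [placeLaw, pushforward_expect, pushforward_dirac, SemidirectProduct.rightHom_eq_right,
    step_right, Fintype.expect_const]

theorem warpTranspose_eq_expect : warpTranspose G n = 𝔼 i, placeLaw i := by
  classical
  ext x
  have hprod : (𝔼 i, placeLaw i : Monomial G n → ℝ) x =
      𝔼 q : Fin n × G, if step q.1 q.2 = x then 1 else 0 := by
    rw [← Finset.univ_product_univ, Finset.expect_product]
    simp only [Finset.expect_apply, placeLaw, dirac, eq_comm (a := x)]
  rw [hprod, warpTranspose_apply, Fintype.expect_eq_sum_div_card, Fintype.card_prod,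
    Fintype.card_fin, Nat.cast_mul]
  split_ifs with hx
  · obtain ⟨q, rfl⟩ := hx
    simp only [step_injective.eq_iff (a := _) (b := q), Finset.sum_ite_eq', Finset.mem_univ,
      if_true]
  · rw [Finset.sum_eq_zero fun q _ => if_neg fun h => hx ⟨q, h⟩, zero_div]

theorem isProb_warpTranspose : IsProb (warpTranspose G n) :=
  warpTranspose_eq_expect (G := G) (n := n) ▸ isProb_expect isProb_placeLaw

theorem pushforward_warpTranspose :
    pushforward SemidirectProduct.rightHom (warpTranspose G n) = starTransposition ⊤ := by
  simp only [warpTranspose_eq_expect, pushforward_expect, pushforward_placeLaw, starTransposition]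

theorem convPow_warpTranspose (k : ℕ) :
    convPow (warpTranspose G n) k = 𝔼 w : Fin k → Fin n, convWord placeLaw (List.ofFn w) := by
  rw [warpTranspose_eq_expect, convPow_expect]

theorem pushforward_convWord_placeLaw (l : List (Fin n)) :
    pushforward SemidirectProduct.rightHom (convWord placeLaw l : Monomial G n → ℝ) =
      dirac (l.map (Equiv.swap · ⊤)).prod := by
  simp only [pushforward_convWord, pushforward_placeLaw, convWord_dirac]

/-! ### Randomised places -/

theorem expect_step_inv_mul_eq {i : Fin n} {A : Finset (Fin n)} {f : Monomial G n → ℝ}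
    (hf : ∀ (π : Equiv.Perm (Fin n)) (z z' : Fin n → G), (∀ j ∉ A, z j = z' j) →
      f ⟨z, π⟩ = f ⟨z', π⟩)
    (hi : i = ⊤ ∨ ⊤ ∈ A) (z : Fin n → G) (π : Equiv.Perm (Fin n)) :
    𝔼 a, f ((step i a)⁻¹ * ⟨z, π⟩) = 𝔼 b, f ⟨Function.update z i b, Equiv.swap i ⊤ * π⟩ := by
  refine Fintype.expect_equiv ((Equiv.inv G).trans (Equiv.mulRight (z ⊤))) _ _ fun a => ?_
  rcases eq_or_ne i ⊤ with rfl | hit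
  · rw [step_top_inv_mul, Equiv.swap_self]
    rfl
  · rw [step_inv_mul hit]
    refine hf _ _ _ fun j hj => ?_
    rw [Function.update_of_ne fun h : j = ⊤ => hj (h ▸ hi.resolve_left hit)]
    rfl

theorem convWord_placeLaw_congr {l : List (Fin n)} {z z' : Fin n → G}
    (h : ∀ j ∉ active ⊤ l, z j = z' j) (π : Equiv.Perm (Fin n)) :
    convWord placeLaw l (⟨z, π⟩ : Monomial G n) = convWord placeLaw l ⟨z', π⟩ := by
  induction l generalizing π z z' with
  | nil => rw [show z = z' from funext fun j => h j (Finset.notMem_empty j)]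
  | cons i l ih =>
    rw [active] at h
    split_ifs at h with hi
    · simp only [convWord, placeLaw_conv, expect_step_inv_mul_eq (fun π _ _ h => ih h π) hi]
      refine Finset.expect_congr rfl fun b _ => ih (fun j hj => ?_) _
      rcases eq_or_ne j i with rfl | hji
      · simp
      · rw [Function.update_of_ne hji, Function.update_of_ne hji]
        exact h j (by simp [hji, hj])
    · rw [show z = z' from funext fun j => h j (Finset.notMem_empty j)]

theorem convWord_placeLaw_of_active_eq_univ {l : List (Fin n)}
    (hl : active ⊤ l = Finset.univ) :
    convWord placeLaw l = uniformEntries G (dirac (l.map (Equiv.swap · ⊤)).prod) := by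
  ext ⟨z, π⟩
  rw [uniformEntries, eq_div_iff (by positivity), ← pushforward_convWord_placeLaw (G := G),
    pushforward_rightHom_apply, Finset.sum_congr rfl fun z' _ => convWord_placeLaw_congr
      (z' := z) (fun j hj => absurd (hl ▸ Finset.mem_univ j) hj) π]
  simp [mul_comm]

theorem tvDist_convPow_warpTranspose_le_add_expect (k : ℕ) :
    tvDist (convPow (warpTranspose G n) k) (unif (Monomial G n)) ≤
      (𝔼 w : Fin k → Fin n, if active ⊤ (List.ofFn w) ≠ Finset.univ then 1 else 0) +
        tvDist (convPow (starTransposition (⊤ : Fin n)) k) (unif (Equiv.Perm (Fin n))) := by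
  have hstar := isProb_convPow (isProb_starTransposition (⊤ : Fin n)) k
  rw [← tvDist_uniformEntries (G := G) (hstar.2.trans (isProb_unif _).2.symm),
    uniformEntries_unif]
  refine (tvDist_triangle _ _ _).trans (add_le_add_left ?_ _)
  rw [convPow_warpTranspose, starTransposition, convPow_expect, uniformEntries_expect]
  simp only [convWord_dirac]
  refine (tvDist_expect_le _ _).trans (Finset.expect_le_expect fun w _ => ?_)
  split_ifs with hw
  · exact tvDist_le_one (isProb_convWord isProb_placeLaw _)
      (isProb_uniformEntries (isProb_dirac _))
  · rw [convWord_placeLaw_of_active_eq_univ (not_not.1 hw)]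
    simp [tvDist]

theorem tvDist_convPow_warpTranspose_le (k : ℕ) :
    tvDist (convPow (warpTranspose G n) k) (unif (Monomial G n)) ≤
      3 * ((n + k) * Real.exp (-(k / n))) := by
  have hactive := expect_active_ne_univ_le (⊤ : Fin n) k
  have hstar := tvDist_convPow_starTransposition_le (⊤ : Fin n) k
  rw [Fintype.card_fin] at hactive hstar
  have he := mul_le_mul_of_nonneg_right Real.exp_one_lt_three.le
    (show 0 ≤ k * Real.exp (-(k / n)) by positivity)
  linear_combination tvDist_convPow_warpTranspose_le_add_expect (G := G) (n := n) k + hactive +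
    hstar + he

theorem tvDist_convPow_starTransposition_le_warpTranspose (k : ℕ) :
    tvDist (convPow (starTransposition (⊤ : Fin n)) k) (unif (Equiv.Perm (Fin n))) ≤
      tvDist (convPow (warpTranspose G n) k) (unif (Monomial G n)) := by
  rw [← pushforward_warpTranspose (G := G), ← pushforward_convPow,
    ← pushforward_unif (G := Monomial G n) _ SemidirectProduct.rightHom_surjective]
  exact tvDist_pushforward_le _ _ _

end Law

end Monomial

namespace RandomWalk

/-! ### Fixed points and the lower bound for star transpositions -/

section FixedPoints

theorem one_sub_four_div_le_expect {Ω : Type*} [Fintype Ω] [Nonempty Ω] {X : Ω → ℝ} {m : ℝ}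
    (hm : 0 < m) (hmean : 𝔼 w, X w = m) (hsq : 𝔼 w, X w ^ 2 ≤ m + m ^ 2) :
    1 - 4 / m ≤ 𝔼 w, if m / 2 ≤ X w then (1 : ℝ) else 0 := by
  -- Chebyshev's inequality, as a parabola below the indicator function of `m / 2 ≤ X`.
  have hpoint (w : Ω) : 8 / m * X w - 4 / m ^ 2 * X w ^ 2 - 3 ≤
      if m / 2 ≤ X w then (1 : ℝ) else 0 := by
    have hsquare : 8 / m * X w - 4 / m ^ 2 * X w ^ 2 - 3 = 1 - (2 / m * X w - 2) ^ 2 := by ring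
    rw [hsquare]
    split_ifs with h
    · linarith [sq_nonneg (2 / m * X w - 2)]
    · have : 2 / m * X w ≤ 1 := by
        rw [div_mul_eq_mul_div, div_le_one hm]
        linarith
      nlinarith
  refine le_trans ?_ (Finset.expect_le_expect fun w _ => hpoint w)
  rw [Finset.expect_sub_distrib, Finset.expect_sub_distrib, ← Finset.mul_expect,
    ← Finset.mul_expect, Fintype.expect_const, hmean]
  have hvar := mul_le_mul_of_nonneg_left hsq (show 0 ≤ 4 / m ^ 2 by positivity)
  have hmm : 4 / m ^ 2 * (m + m ^ 2) = 4 / m + 4 := by field_simp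
  have hm8 : 8 / m * m = 8 := by field_simp
  linarith

variable {α : Type*} [Fintype α] [DecidableEq α]

theorem expect_card_fixedPoints [Nonempty α] :
    𝔼 σ : Equiv.Perm α, (Finset.card {j | σ j = j} : ℝ) = 1 := by
  classical
  have hburnside := MulAction.sum_card_fixedBy_eq_card_orbits_mul_card_group (Equiv.Perm α) α
  have horbits : Fintype.card (MulAction.orbitRel.Quotient (Equiv.Perm α) α) = 1 :=
    Fintype.card_eq_one_iff_nonempty_unique.2 <|
      (MulAction.pretransitive_iff_unique_quotient_of_nonempty _ _).1 inferInstance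
  rw [horbits, one_mul] at hburnside
  have hfixed (σ : Equiv.Perm α) :
      Finset.card {j | σ j = j} = Fintype.card (MulAction.fixedBy α σ) :=
    (Fintype.card_subtype _).symm
  simp only [hfixed]
  rw [Fintype.expect_eq_sum_div_card, ← Nat.cast_sum, hburnside, div_self (by positivity)]

omit [Fintype α] in
theorem prod_map_swap_apply_of_notMem {t j : α} (hj : j ≠ t) {l : List α} (hl : j ∉ l) :
    (l.map (Equiv.swap · t)).prod j = j := by
  induction l with
  | nil => rfl
  | cons i l ih =>
    rw [List.mem_cons, not_or] at hl
    rw [List.map_cons, List.prod_cons, Equiv.Perm.mul_apply, ih hl.2,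
      Equiv.swap_apply_of_ne_of_ne hl.1 hj]

theorem sum_convPow_starTransposition_mul (t : α) (k : ℕ) (f : Equiv.Perm α → ℝ) :
    ∑ σ, convPow (starTransposition t) k σ * f σ =
      𝔼 w : Fin k → α, f ((List.ofFn w).map (Equiv.swap · t)).prod := by
  rw [starTransposition, convPow_expect, sum_expect_mul]
  simp only [convWord_dirac, sum_dirac_mul]

theorem one_sub_four_div_le_sum_convPow_starTransposition (t : α) (k : ℕ) {m : ℝ}
    (hm : m = (Fintype.card α - 1) * (1 - 1 / Fintype.card α) ^ k) (hm0 : 0 < m) :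
    1 - 4 / m ≤ ∑ σ with m / 2 ≤ Finset.card {j | (σ : Equiv.Perm α) j = j},
      convPow (starTransposition t) k σ := by
  have : Nonempty α := ⟨t⟩
  have hcard : ((Finset.univ.erase t).card : ℝ) = Fintype.card α - 1 := by
    rw [Finset.card_erase_of_mem (Finset.mem_univ t), Finset.card_univ,
      Nat.cast_pred Fintype.card_pos]
  have hmean := expect_card_filter_notMem (Finset.univ.erase t) k
  have hsq := expect_card_filter_notMem_sq_le (Finset.univ.erase t) k
  rw [hcard, ← hm] at hmean hsq
  refine (one_sub_four_div_le_expect hm0 hmean hsq).trans ?_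
  have hlaw := sum_convPow_starTransposition_mul t k fun σ =>
    if m / 2 ≤ Finset.card {j | σ j = j} then 1 else 0
  simp only [mul_ite, mul_one, mul_zero, ← Finset.sum_filter] at hlaw
  rw [hlaw]
  refine Finset.expect_le_expect fun w _ => ?_
  have hmissing : Finset.card {j ∈ Finset.univ.erase t | j ∉ List.ofFn w} ≤
      Finset.card {j | ((List.ofFn w).map (Equiv.swap · t)).prod j = j} :=
    Finset.card_le_card fun j hj => by
      rw [Finset.mem_filter] at hj ⊢
      exact ⟨Finset.mem_univ j,
        prod_map_swap_apply_of_notMem (Finset.ne_of_mem_erase hj.1) hj.2⟩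
  have hmissing' := Nat.cast_le (α := ℝ).2 hmissing
  split_ifs with h h'
  · exact le_rfl
  · exact absurd (h.trans hmissing') h'
  · exact zero_le_one
  · exact le_rfl

theorem sum_unif_fixedPoints_le [Nonempty α] {m : ℝ} (hm : 0 < m) :
    ∑ σ with m / 2 ≤ Finset.card {j | (σ : Equiv.Perm α) j = j}, unif (Equiv.Perm α) σ ≤
      2 / m := by
  have hmean : 𝔼 σ : Equiv.Perm α, 2 / m * (Finset.card {j | σ j = j} : ℝ) = 2 / m := by
    rw [← Finset.mul_expect, expect_card_fixedPoints, mul_one]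
  rw [← hmean, Fintype.expect_eq_sum_div_card, Finset.sum_div, Finset.sum_filter]
  refine Finset.sum_le_sum fun σ _ => ?_
  split_ifs with h
  · rw [unif]
    gcongr
    rw [div_mul_eq_mul_div, one_le_div hm]
    linarith
  · positivity

theorem one_sub_six_div_le_tvDist_convPow_starTransposition (t : α) (k : ℕ) {m : ℝ}
    (hm : m = (Fintype.card α - 1) * (1 - 1 / Fintype.card α) ^ k) (hm0 : 0 < m) :
    1 - 6 / m ≤ tvDist (convPow (starTransposition t) k) (unif (Equiv.Perm α)) := by
  have : Nonempty α := ⟨t⟩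
  have hstar := one_sub_four_div_le_sum_convPow_starTransposition t k hm hm0
  have hunif := sum_unif_fixedPoints_le (α := α) hm0
  have htv := (le_abs_self _).trans (abs_sum_sub_sum_le_tvDist (convPow (starTransposition t) k)
    (unif (Equiv.Perm α)) {σ | m / 2 ≤ Finset.card {j | σ j = j}})
  have hsix : 6 / m = 4 / m + 2 / m := by ring
  linarith

end FixedPoints

end RandomWalk

namespace Monomial

open RandomWalk

/-! ### Generation -/

section Generation

variable {G : Type*} [Group G] {n : ℕ} [NeZero n]

theorem step_one (i : Fin n) :
    (step i 1 : Monomial G n) = SemidirectProduct.inr (Equiv.swap i ⊤) := by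
  ext j
  · rcases eq_or_ne i ⊤ with rfl | hi
    · simp [step, lastElt]
    · simp [step, hi, warpElt]
  · rw [step_right, SemidirectProduct.right_inr]

theorem step_top (g : G) :
    (step ⊤ g : Monomial G n) = SemidirectProduct.inl (Pi.mulSingle ⊤ g) :=
  if_pos rfl

theorem inl_mulSingle_eq (i : Fin n) (g : G) :
    (SemidirectProduct.inl (Pi.mulSingle i g) : Monomial G n) =
      SemidirectProduct.inr (Equiv.swap i ⊤) * SemidirectProduct.inl (Pi.mulSingle ⊤ g) *
        SemidirectProduct.inr (Equiv.swap i ⊤)⁻¹ := by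
  rw [← SemidirectProduct.inl_aut]
  congr 1
  ext j
  change _ = (Pi.mulSingle ⊤ g : Fin n → G) ((Equiv.swap i ⊤)⁻¹ j)
  simp only [Pi.mulSingle_apply, Equiv.swap_inv, Equiv.swap_apply_eq_iff, Equiv.swap_apply_right]

theorem closure_range_step :
    Subgroup.closure (Set.range fun q : Fin n × G => step q.1 q.2) = ⊤ := by
  set H := Subgroup.closure (Set.range fun q : Fin n × G => step q.1 q.2)
  have hstep (i : Fin n) (g : G) : step i g ∈ H := Subgroup.subset_closure ⟨(i, g), rfl⟩
  have hinr (π : Equiv.Perm (Fin n)) : (SemidirectProduct.inr π : Monomial G n) ∈ H := by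
    have hπ : π ∈ Subgroup.closure ((Equiv.swap · ⊤) '' {⊤}ᶜ) :=
      mem_closure_swap_of_forall_apply_eq (by simp) fun d hd hd' => absurd hd hd'
    refine (Subgroup.closure_le (H.comap SemidirectProduct.inr)).2 ?_ hπ
    rintro _ ⟨i, -, rfl⟩
    have hi := hstep i 1
    rwa [step_one] at hi
  have hinl (i : Fin n) (g : G) :
      (SemidirectProduct.inl (Pi.mulSingle i g) : Monomial G n) ∈ H := by
    rw [inl_mulSingle_eq, ← step_top]
    exact H.mul_mem (H.mul_mem (hinr _) (hstep ⊤ g)) (hinr _)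
  rw [eq_top_iff]
  rintro ⟨z, π⟩ -
  rw [SemidirectProduct.mk_eq_inl_mul_inr]
  exact H.mul_mem (Subgroup.pi_mem_of_mulSingle_mem (H := H.comap SemidirectProduct.inl) z
    fun i => hinl i (z i)) (hinr π)

variable [Fintype G]

theorem support_warpTranspose :
    Function.support (warpTranspose G n) = Set.range fun q : Fin n × G => step q.1 q.2 := by
  classical
  ext x
  have hn : (n : ℝ) ≠ 0 := Nat.cast_ne_zero.2 (NeZero.ne n)
  rw [Function.mem_support, warpTranspose_apply, ite_ne_right_iff, Set.mem_range]
  exact and_iff_left (by positivity)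

theorem closure_support_warpTranspose :
    Subgroup.closure (Function.support (warpTranspose G n)) = ⊤ := by
  rw [support_warpTranspose, closure_range_step]

theorem warpTranspose_one_pos : 0 < warpTranspose G n 1 := by
  have hone : (1 : Monomial G n) ∈ Function.support (warpTranspose G n) := by
    rw [support_warpTranspose]
    exact ⟨(⊤, 1), (step_top 1).trans (by rw [Pi.mulSingle_one, map_one])⟩
  exact (isProb_warpTranspose.1 1).lt_of_ne' hone

end Generation

end Monomial

namespace RandomWalk

/-! ### Asymptotics -/

theorem tendsto_add_floor_mul_exp {ε : ℝ} (hε : 0 < ε) :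
    Tendsto (fun x : ℝ => (x + ⌊(1 + ε) * (x * Real.log x)⌋₊) *
      Real.exp (-(⌊(1 + ε) * (x * Real.log x)⌋₊ / x))) atTop (𝓝 0) := by
  have hpow : Tendsto (fun x : ℝ => x ^ (-ε)) atTop (𝓝 0) := tendsto_rpow_neg_atTop hε
  have hlog : Tendsto (fun x : ℝ => Real.log x * x ^ (-ε)) atTop (𝓝 0) := by
    refine (isLittleO_log_rpow_atTop hε).tendsto_div_nhds_zero.congr' ?_
    filter_upwards [eventually_gt_atTop 0] with x hx
    rw [Real.rpow_neg hx.le, div_eq_mul_inv]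
  have hbound := ((hpow.add (hlog.const_mul (1 + ε))).const_mul (Real.exp 1))
  simp only [mul_zero, add_zero] at hbound
  refine squeeze_zero' ?_ ?_ hbound
  · filter_upwards [eventually_ge_atTop 0] with x hx
    positivity
  filter_upwards [eventually_ge_atTop 1] with x hx
  have hx0 : 0 < x := by linarith
  set k := ⌊(1 + ε) * (x * Real.log x)⌋₊
  have hlog0 : 0 ≤ Real.log x := Real.log_nonneg hx
  have hk : (k : ℝ) ≤ (1 + ε) * (x * Real.log x) := Nat.floor_le (by positivity)
  have hk' : (1 + ε) * (x * Real.log x) ≤ k + 1 := (Nat.lt_floor_add_one _).le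
  have hexp : Real.exp (-(k / x)) ≤ Real.exp 1 * x ^ (-(1 + ε)) := by
    rw [Real.rpow_def_of_pos hx0, ← Real.exp_add, Real.exp_le_exp, neg_le, le_div_iff₀ hx0]
    linarith
  have hsplit : x ^ (-ε) = x * x ^ (-(1 + ε)) := by
    rw [← Real.rpow_one_add' hx0.le (by linarith)]
    ring_nf
  calc (x + k) * Real.exp (-(k / x))
      ≤ (x + (1 + ε) * (x * Real.log x)) * (Real.exp 1 * x ^ (-(1 + ε))) := by gcongr
    _ = Real.exp 1 * (x ^ (-ε) + (1 + ε) * (Real.log x * x ^ (-ε))) := by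
      rw [hsplit]
      ring

theorem exp_neg_one_div_sub_one_le {x : ℝ} (hx : 1 < x) :
    Real.exp (-(1 / (x - 1))) ≤ 1 - 1 / x := by
  have hx1 : 0 < x - 1 := sub_pos.2 hx
  have hinv : 1 - 1 / x = (1 / (x - 1) + 1)⁻¹ := by
    field_simp
    ring
  rw [hinv, Real.exp_neg]
  exact inv_anti₀ (by positivity) (Real.add_one_le_exp _)

theorem tendsto_sub_one_mul_one_sub_pow {ε : ℝ} (hε : 0 < ε) (hε1 : ε < 1) :
    Tendsto (fun x : ℝ => (x - 1) * (1 - 1 / x) ^ ⌊(1 - ε) * (x * Real.log x)⌋₊) atTop atTop := by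
  have hbound := (tendsto_rpow_atTop hε).atTop_div_const (r := 2 * Real.exp 1) (by positivity)
  refine tendsto_atTop_mono' _ ?_ hbound
  filter_upwards [eventually_ge_atTop 2] with x hx
  have hx0 : 0 < x := by linarith
  have hx1 : 0 < x - 1 := by linarith
  have hlog0 : 0 ≤ Real.log x := Real.log_nonneg (by linarith)
  have hlog1 : Real.log x ≤ x - 1 := Real.log_le_sub_one_of_pos hx0
  set k := ⌊(1 - ε) * (x * Real.log x)⌋₊
  have hk : (k : ℝ) ≤ (1 - ε) * (x * Real.log x) :=
    Nat.floor_le (mul_nonneg (sub_nonneg.2 hε1.le) (by positivity))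
  have hexponent : k * (1 / (x - 1)) ≤ 1 + (1 - ε) * Real.log x := by
    rw [mul_one_div, div_le_iff₀ hx1]
    nlinarith
  have hpow : Real.exp (-1) * x ^ (ε - 1) ≤ (1 - 1 / x) ^ k := by
    refine le_trans ?_ (pow_le_pow_left₀ (Real.exp_pos _).le
      (exp_neg_one_div_sub_one_le (by linarith)) k)
    rw [← Real.exp_nat_mul, Real.rpow_def_of_pos hx0, ← Real.exp_add, Real.exp_le_exp]
    linarith
  calc x ^ ε / (2 * Real.exp 1) = x / 2 * (Real.exp (-1) * x ^ (ε - 1)) := by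
        rw [Real.rpow_sub_one hx0.ne', Real.exp_neg]
        field_simp
    _ ≤ (x - 1) * (1 - 1 / x) ^ k :=
        mul_le_mul (by linarith) hpow (by positivity) hx1.le

theorem tendsto_tvDist_one_of_le {ι : Type*} {l : Filter ι} {Ω : ι → Type*}
    [∀ i, Fintype (Ω i)] {μ ν : ∀ i, Ω i → ℝ} (hμ : ∀ i, IsProb (μ i)) (hν : ∀ i, IsProb (ν i))
    {m : ι → ℝ} (hm : Tendsto m l atTop) {c : ℝ}
    (h : ∀ i, 0 < m i → 1 - c / m i ≤ tvDist (μ i) (ν i)) :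
    Tendsto (fun i => tvDist (μ i) (ν i)) l (𝓝 1) := by
  have hlim : Tendsto (fun i => 1 - c / m i) l (𝓝 1) := by
    simpa using (hm.const_div_atTop c).const_sub 1
  refine tendsto_of_tendsto_of_tendsto_of_le_of_le' hlim tendsto_const_nhds ?_
    (Eventually.of_forall fun i => tvDist_le_one (hμ i) (hν i))
  filter_upwards [hm.eventually_gt_atTop 0] with i hi using h i hi

end RandomWalk

namespace Monomial

open RandomWalk

theorem one_sub_six_div_le_tvDist_convPow_warpTranspose {G : Type*} [Group G] [Fintype G] {n : ℕ}
    [NeZero n] (k : ℕ) (hm : 0 < ((n : ℝ) - 1) * (1 - 1 / n) ^ k) :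
    1 - 6 / (((n : ℝ) - 1) * (1 - 1 / n) ^ k) ≤
      tvDist (convPow (warpTranspose G n) k) (unif (Monomial G n)) :=
  (one_sub_six_div_le_tvDist_convPow_starTransposition ⊤ k (by rw [Fintype.card_fin]) hm).trans
    (tvDist_convPow_starTransposition_le_warpTranspose k)

end Monomial

theorem mainTheorem1_general {ι : Type*} [Preorder ι] {N : ι → ℕ} [∀ i, NeZero (N i)]
    (hN : Tendsto N atTop atTop) (G : ι → Type*) [∀ i, Group (G i)] [∀ i, Fintype (G i)] :
    RandomWalk.HasTVCutoff (fun i => Monomial (G i) (N i))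
      (fun i => Monomial.warpTranspose (G i) (N i)) (fun i => (N i : ℝ) * Real.log (N i)) := by
  have hN' : Tendsto (fun i => (N i : ℝ)) atTop atTop := tendsto_natCast_atTop_atTop.comp hN
  exact
  { isProb := fun _ => Monomial.isProb_warpTranspose
    generates := fun _ => Monomial.closure_support_warpTranspose
    irreducible := fun _ => RandomWalk.isIrred_transition Monomial.isProb_warpTranspose.1
      Monomial.closure_support_warpTranspose
    aperiodic := fun _ => RandomWalk.isAperiodic_transition Monomial.warpTranspose_one_pos
    tendsto_time := hN'.atTop_mul_atTop₀ (Real.tendsto_log_atTop.comp hN')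
    upper := fun ε hε _ => squeeze_zero (fun _ => RandomWalk.tvDist_nonneg _ _)
      (fun _ => Monomial.tvDist_convPow_warpTranspose_le _)
      (by simpa using ((RandomWalk.tendsto_add_floor_mul_exp hε).comp hN').const_mul 3)
    lower := fun ε hε hε1 => RandomWalk.tendsto_tvDist_one_of_le
      (fun _ => RandomWalk.isProb_convPow Monomial.isProb_warpTranspose _)
      (fun _ => RandomWalk.isProb_unif _)
      ((RandomWalk.tendsto_sub_one_mul_one_sub_pow hε hε1).comp hN')
      fun _ => Monomial.one_sub_six_div_le_tvDist_convPow_warpTranspose _ }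

theorem mainTheorem1 (G : ℕ+ → Type*) [∀ n, Group (G n)] [∀ n, Fintype (G n)]
    [∀ n, Nontrivial (G n)] :
    RandomWalk.HasTVCutoff (fun n : ℕ+ => Monomial (G n) (n : ℕ))
      (fun n : ℕ+ => Monomial.warpTranspose (G n) (n : ℕ))
      (fun n : ℕ+ => (n : ℝ) * Real.log (n : ℝ)) :=
  mainTheorem1_general tendsto_PNat_val_atTop_atTop G
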